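/- Let $p,q\in(1,\infty)$ with $\frac1p+\frac1q=1$. There is a constant $C$ depending only on $p$ such that the following holds. Let $\mathfrak H$ be a real separable Hilbert space and let $W=\{W(h):h\in\mathfrak H\}$ and $\widehat W=\{\widehat W(h):h\in\mathfrak H\}$ be two independent isonormal Gaussian processes over $\mathfrak H$ defined on a common probability space, that is, each is a centered jointly Gaussian family of random variables with covariance $\mathbb E[W(\varphi)W(\psi)]=\mathbb E[\widehat W(\varphi)\widehat W(\psi)]=\langle\varphi,\psi\rangle_{\mathfrak H}$. Let $F_1,F_2:\mathbb R^{\mathfrak H}\to\mathbb R$ be measurable (with respect to the product $\sigma$-algebra), with $F_1(W)\in L^p(\Omega)$, $F_2(W)\in L^q(\Omega)$ and $\mathbb E[F_1(W)]=\mathbb E[F_2(W)]=0$. Then, for every $\theta\in[-1,1]$, the random variable $F_1(W)\,F_2(\theta W+\sqrt{1-\theta^2}\,\widehat W)$ is integrable and $$\bigl|\mathbb E[F_1(W)\,F_2(\theta W+\sqrt{1-\theta^2}\,\widehat W)]\bigr|\le C\,|\theta|\,\|F_1(W)\|_{L^p(\Omega)}\,\|F_2(W)\|_{L^q(\Omega)}.$$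 -/

import Mathlib

universe u v

open MeasureTheory ProbabilityTheory

/-- `W = {W(h) : h ∈ H}` is an isonormal Gaussian process over the real Hilbert space `H`, on the
probability space `(Ω, P)`: a centered, jointly Gaussian family of (real) random variables with
covariance `E[W(φ) W(ψ)] = ⟨φ, ψ⟩`. -/
structure IsIsonormalProcess {H : Type u} [NormedAddCommGroup H] [InnerProductSpace ℝ H]
    {Ω : Type v} [MeasurableSpace Ω] (W : H → Ω → ℝ) (P : Measure Ω) : Prop where
  measurable : ∀ h : H, Measurable (W h)
  isGaussianProcess : IsGaussianProcess W P
  centered : ∀ h : H, ∫ ω, W h ω ∂P = 0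
  covariance : ∀ φ ψ : H, ∫ ω, W φ ω * W ψ ω ∂P = inner ℝ φ ψ

/-! Let `T_θ` be the Ornstein–Uhlenbeck (Mehler) operator at correlation `θ`, and fix an integer `N
≥ max p q` and `ε = 1/(2N)`. If `|θ| ≥ ε`, Hölder's inequality suffices with constant `2N`, because
`W` and `θW + √(1-θ²)Ŵ` have the same law. If `|θ| ≤ ε`, factor `T_θ = T_{θ/ε} T_ε`. The first
factor contracts centred functions in `L²` by `|θ|/ε = 2N|θ|`, which supplies the linear decay. The
second is hypercontractive, mapping `Lʳ` to `L²` with norm at most one, where `r` is conjugate to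
`2N`. Since `p, q ≤ 2N`, both are at least `r`; since they are conjugate, one of them is at least
`2`. That function takes the `L²` norm and the other the `Lʳ` norm.

Both operator bounds are proved on the two-point space (`correlationBound_bitKernel`,
`hypercontractiveBound_bitKernel`). They tensorize without loss of constant, and combine on the cube
in `abs_cov_cube_le`. A central limit theorem for correlated signs carries the estimate to Gaussian
vectors (`abs_cov_le_of_charFun`). Density of bounded continuous cylinder functions then gives all
of `Lᵖ × L^q` (`abs_cov_le_of_forall_isBoundedCylinder`). An even integer exponent `2N` makes the
two-point moment inequality polynomial; the value of `ε` is not optimal, as any constant depending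
on `p` will do. -/

/-! ### Couplings on finite types -/

/-- `k` is a coupling of the weight `m` on a finite type with itself. -/
structure IsFiniteCoupling {V : Type*} [Fintype V] (m : V → ℝ) (k : V → V → ℝ) : Prop where
  nonneg : ∀ x y, 0 ≤ k x y
  sum_right : ∀ x, ∑ y, k x y = m x
  sum_left : ∀ y, ∑ x, k x y = m y
  sum_eq_one : ∑ x, m x = 1

/-- The weighted mean of `f` with respect to `m`. -/
def wMean {V : Type*} [Fintype V] (m : V → ℝ) (f : V → ℝ) : ℝ := ∑ x, m x * f x

/-- The bilinear form of the kernel `k`. -/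
def wForm {V : Type*} [Fintype V] (k : V → V → ℝ) (f g : V → ℝ) : ℝ :=
  ∑ x, ∑ y, k x y * (f x * g y)

/-- The maximal correlation of the coupling `k` is at most `ρ`, in polarized form. -/
def CorrelationBound {V : Type*} [Fintype V] (m : V → ℝ) (k : V → V → ℝ) (ρ : ℝ) : Prop :=
  ∀ f g : V → ℝ, 2 * (wForm k f g - wMean m f * wMean m g) ≤
    ρ * ((wMean m (fun x => f x ^ 2) - wMean m f ^ 2) +
      (wMean m (fun x => g x ^ 2) - wMean m g ^ 2))

/-- The bilinear form of `k` is bounded by the `L²` norm times the `Lʳ` norm. -/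
def HypercontractiveBound {V : Type*} [Fintype V] (m : V → ℝ) (k : V → V → ℝ) (r : ℝ) : Prop :=
  ∀ f g : V → ℝ, wForm k f g ≤
    √(wMean m (fun x => f x ^ 2)) * wMean m (fun x => |g x| ^ r) ^ (1 / r)

section Finite

variable {V V₁ V₂ : Type*} [Fintype V] [Fintype V₁] [Fintype V₂]

lemma IsFiniteCoupling.weight_nonneg {m : V → ℝ} {k : V → V → ℝ} (h : IsFiniteCoupling m k)
    (x : V) : 0 ≤ m x := by
  rw [← h.sum_right x]; exact Finset.sum_nonneg fun y _ => h.nonneg x y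

lemma IsFiniteCoupling.wMean_nonneg {m : V → ℝ} {k : V → V → ℝ} (h : IsFiniteCoupling m k)
    {f : V → ℝ} (hf : ∀ x, 0 ≤ f x) : 0 ≤ wMean m f :=
  Finset.sum_nonneg fun x _ => mul_nonneg (h.weight_nonneg x) (hf x)

lemma IsFiniteCoupling.wForm_mono {m : V → ℝ} {k : V → V → ℝ} (h : IsFiniteCoupling m k)
    {F G : V → V → ℝ} (hFG : ∀ x y, F x y ≤ G x y) :
    ∑ x, ∑ y, k x y * F x y ≤ ∑ x, ∑ y, k x y * G x y :=
  Finset.sum_le_sum fun x _ => Finset.sum_le_sum fun y _ =>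
    mul_le_mul_of_nonneg_left (hFG x y) (h.nonneg x y)

lemma IsFiniteCoupling.sum_sum_left {m : V → ℝ} {k : V → V → ℝ} (h : IsFiniteCoupling m k)
    (f : V → ℝ) : ∑ x, ∑ y, k x y * f x = wMean m f := by
  simp [wMean, ← Finset.sum_mul, h.sum_right]

lemma IsFiniteCoupling.sum_sum_right {m : V → ℝ} {k : V → V → ℝ} (h : IsFiniteCoupling m k)
    (f : V → ℝ) : ∑ x, ∑ y, k x y * f y = wMean m f := by
  rw [Finset.sum_comm]
  simp [wMean, ← Finset.sum_mul, h.sum_left]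

lemma wMean_prod (m₁ : V₁ → ℝ) (m₂ : V₂ → ℝ) (f : V₁ × V₂ → ℝ) :
    wMean (fun x : V₁ × V₂ => m₁ x.1 * m₂ x.2) f =
      wMean m₁ (fun a => wMean m₂ (fun b => f (a, b))) := by
  simp only [wMean, Fintype.sum_prod_type, Finset.mul_sum, mul_assoc]

lemma wForm_prod (k₁ : V₁ → V₁ → ℝ) (k₂ : V₂ → V₂ → ℝ) (f g : V₁ × V₂ → ℝ) :
    wForm (fun x y : V₁ × V₂ => k₁ x.1 y.1 * k₂ x.2 y.2) f g =
      ∑ a, ∑ a', k₁ a a' * wForm k₂ (fun b => f (a, b)) (fun b => g (a', b)) := by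
  simp only [wForm, Fintype.sum_prod_type, Finset.mul_sum, mul_assoc]
  refine Finset.sum_congr rfl fun a _ => ?_
  rw [Finset.sum_comm]

lemma IsFiniteCoupling.prod {m₁ : V₁ → ℝ} {k₁ : V₁ → V₁ → ℝ} {m₂ : V₂ → ℝ} {k₂ : V₂ → V₂ → ℝ}
    (h₁ : IsFiniteCoupling m₁ k₁) (h₂ : IsFiniteCoupling m₂ k₂) :
    IsFiniteCoupling (fun x : V₁ × V₂ => m₁ x.1 * m₂ x.2)
      (fun x y => k₁ x.1 y.1 * k₂ x.2 y.2) where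
  nonneg x y := mul_nonneg (h₁.nonneg _ _) (h₂.nonneg _ _)
  sum_right x := by
    rw [Fintype.sum_prod_type, ← h₁.sum_right, ← h₂.sum_right, Finset.sum_mul_sum]
  sum_left x := by
    rw [Fintype.sum_prod_type, ← h₁.sum_left, ← h₂.sum_left, Finset.sum_mul_sum]
  sum_eq_one := by
    rw [Fintype.sum_prod_type, ← Finset.sum_mul_sum, h₁.sum_eq_one, h₂.sum_eq_one, one_mul]

/-- Law of total covariance: `c₂` bounds the conditional covariances given the first coordinates,
and `c₁` bounds the covariance of the conditional means `f'`, `g'`. In polarized form the right side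
is a function of `a` plus a function of `a'`, so summing against `k₁` only sees its marginals. -/
lemma CorrelationBound.prod {m₁ : V₁ → ℝ} {k₁ : V₁ → V₁ → ℝ} {m₂ : V₂ → ℝ} {k₂ : V₂ → V₂ → ℝ}
    {ρ : ℝ} (h₁ : IsFiniteCoupling m₁ k₁)
    (c₁ : CorrelationBound m₁ k₁ ρ) (c₂ : CorrelationBound m₂ k₂ ρ) :
    CorrelationBound (fun x : V₁ × V₂ => m₁ x.1 * m₂ x.2)
      (fun x y => k₁ x.1 y.1 * k₂ x.2 y.2) ρ := by
  intro f g
  simp only [wMean_prod, wForm_prod]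
  set f' : V₁ → ℝ := fun a => wMean m₂ fun b => f (a, b) with hf'
  set g' : V₁ → ℝ := fun a => wMean m₂ fun b => g (a, b) with hg'
  set vf : V₁ → ℝ := fun a => wMean m₂ fun b => f (a, b) ^ 2 with hvf
  set vg : V₁ → ℝ := fun a => wMean m₂ fun b => g (a, b) ^ 2 with hvg
  have e₁ := c₁ f' g'
  have e₂ := h₁.wForm_mono (F := fun a a' => 2 * (wForm k₂ (fun b => f (a, b)) (fun b => g (a', b))
      - f' a * g' a')) (G := fun a a' => ρ * (vf a - f' a ^ 2) + ρ * (vg a' - g' a' ^ 2))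
      (fun a a' => by rw [← mul_add]; exact c₂ _ _)
  simp only [mul_add, Finset.sum_add_distrib] at e₂
  rw [h₁.sum_sum_left (fun a => ρ * (vf a - f' a ^ 2)),
    h₁.sum_sum_right (fun a => ρ * (vg a - g' a ^ 2))] at e₂
  have l₁ : ∀ u w : V₁ → ℝ, wMean m₁ (fun a => ρ * (u a - w a ^ 2)) =
      ρ * (wMean m₁ u - wMean m₁ fun a => w a ^ 2) := by
    intro u w
    simp only [wMean, Finset.mul_sum, ← Finset.sum_sub_distrib]
    exact Finset.sum_congr rfl fun _ _ => by ring
  rw [l₁, l₁] at e₂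
  have l₂ : ∑ a, ∑ a', k₁ a a' * (2 * (wForm k₂ (fun b => f (a, b)) (fun b => g (a', b))
      - f' a * g' a')) = 2 * (∑ a, ∑ a', k₁ a a' * wForm k₂ (fun b => f (a, b)) (fun b => g (a', b))
      - wForm k₁ f' g') := by
    rw [wForm, ← Finset.sum_sub_distrib, Finset.mul_sum]
    refine Finset.sum_congr rfl fun a _ => ?_
    rw [← Finset.sum_sub_distrib, Finset.mul_sum]
    exact Finset.sum_congr rfl fun _ _ => by ring
  rw [l₂] at e₂
  linarith

/-- Norms on a product are iterated norms: bound the inner form by `c₂`, then apply `c₁` to the two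
functions of the first coordinate formed by the inner norms. -/
lemma HypercontractiveBound.prod {m₁ : V₁ → ℝ} {k₁ : V₁ → V₁ → ℝ} {m₂ : V₂ → ℝ}
    {k₂ : V₂ → V₂ → ℝ} {r : ℝ} (hr : 0 < r)
    (h₁ : IsFiniteCoupling m₁ k₁) (h₂ : IsFiniteCoupling m₂ k₂)
    (c₁ : HypercontractiveBound m₁ k₁ r) (c₂ : HypercontractiveBound m₂ k₂ r) :
    HypercontractiveBound (fun x : V₁ × V₂ => m₁ x.1 * m₂ x.2)
      (fun x y => k₁ x.1 y.1 * k₂ x.2 y.2) r := by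
  intro f g
  simp only [wMean_prod, wForm_prod]
  refine (h₁.wForm_mono fun a a' => c₂ (fun b => f (a, b)) (fun b => g (a', b))).trans ?_
  refine (c₁ (fun a => √(wMean m₂ fun b => f (a, b) ^ 2))
    (fun a => wMean m₂ (fun b => |g (a, b)| ^ r) ^ (1 / r))).trans (le_of_eq ?_)
  have hn : ∀ a, 0 ≤ wMean m₂ (fun b => |g (a, b)| ^ r) :=
    fun a => h₂.wMean_nonneg fun b => by positivity
  congr 2
  · congr 1; ext a
    exact Real.sq_sqrt (h₂.wMean_nonneg fun b => by positivity)
  · congr 1; ext a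
    rw [abs_of_nonneg (Real.rpow_nonneg (hn a) _), ← Real.rpow_mul (hn a),
      one_div_mul_cancel hr.ne', Real.rpow_one]

lemma wMean_comp_equiv (e : V₁ ≃ V₂) (m : V₂ → ℝ) (f : V₁ → ℝ) :
    wMean (fun x => m (e x)) f = wMean m (fun y => f (e.symm y)) := by
  simp only [wMean]
  exact Fintype.sum_equiv e _ _ fun x => by simp

lemma wForm_comp_equiv (e : V₁ ≃ V₂) (k : V₂ → V₂ → ℝ) (f g : V₁ → ℝ) :
    wForm (fun x y => k (e x) (e y)) f g =
      wForm k (fun y => f (e.symm y)) (fun y => g (e.symm y)) := by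
  simp only [wForm]
  exact Fintype.sum_equiv e _ _ fun x => Fintype.sum_equiv e _ _ fun y => by simp

lemma IsFiniteCoupling.comp_equiv (e : V₁ ≃ V₂) {m : V₂ → ℝ} {k : V₂ → V₂ → ℝ}
    (h : IsFiniteCoupling m k) :
    IsFiniteCoupling (fun x => m (e x)) (fun x y => k (e x) (e y)) where
  nonneg x y := h.nonneg _ _
  sum_right x := by rw [← h.sum_right]; exact e.sum_comp (k (e x))
  sum_left x := by rw [← h.sum_left]; exact e.sum_comp (fun y => k y (e x))
  sum_eq_one := by rw [← h.sum_eq_one]; exact e.sum_comp m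

lemma CorrelationBound.comp_equiv (e : V₁ ≃ V₂) {m : V₂ → ℝ} {k : V₂ → V₂ → ℝ} {ρ : ℝ}
    (h : CorrelationBound m k ρ) :
    CorrelationBound (fun x => m (e x)) (fun x y => k (e x) (e y)) ρ := by
  intro f g
  simp only [wForm_comp_equiv, wMean_comp_equiv]
  exact h _ _

lemma HypercontractiveBound.comp_equiv (e : V₁ ≃ V₂) {m : V₂ → ℝ} {k : V₂ → V₂ → ℝ} {r : ℝ}
    (h : HypercontractiveBound m k r) :
    HypercontractiveBound (fun x => m (e x)) (fun x y => k (e x) (e y)) r := by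
  intro f g
  simp only [wForm_comp_equiv, wMean_comp_equiv]
  exact h _ _

end Finite

/-! ### Tensor powers -/

/-- The product weight on `ι → V`. -/
def piWeight {V : Type*} (ι : Type*) [Fintype ι] (m : V → ℝ) (x : ι → V) : ℝ := ∏ i, m (x i)

/-- The product kernel on `ι → V`. -/
def piKernel {V : Type*} (ι : Type*) [Fintype ι] (k : V → V → ℝ) (x y : ι → V) : ℝ :=
  ∏ i, k (x i) (y i)

/-- Closure under relabelling replaces identifications of types: an arbitrary index type is
transported to `Fin n`, and `Fin (n + 1) → V` is split as `V × (Fin n → V)`. -/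
lemma pi_induction {V : Type} [Fintype V]
    {Q : ∀ (X : Type) [Fintype X], (X → ℝ) → (X → X → ℝ) → Prop}
    (equiv : ∀ (X Y : Type) [Fintype X] [Fintype Y] (e : X ≃ Y) (m : Y → ℝ) (k : Y → Y → ℝ),
      Q Y m k → Q X (fun x => m (e x)) (fun x y => k (e x) (e y)))
    (unit : Q Unit (fun _ => 1) (fun _ _ => 1))
    (prod : ∀ (X Y : Type) [Fintype X] [Fintype Y] (m₁ : X → ℝ) (k₁ : X → X → ℝ) (m₂ : Y → ℝ)
      (k₂ : Y → Y → ℝ), Q X m₁ k₁ → Q Y m₂ k₂ →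
      Q (X × Y) (fun x => m₁ x.1 * m₂ x.2) (fun x y => k₁ x.1 y.1 * k₂ x.2 y.2))
    (m : V → ℝ) (k : V → V → ℝ) (h : Q V m k) (ι : Type) [Fintype ι] [DecidableEq ι] :
    Q (ι → V) (piWeight ι m) (piKernel ι k) := by
  have fin : ∀ n : ℕ, Q (Fin n → V) (piWeight (Fin n) m) (piKernel (Fin n) k) := by
    intro n
    induction n with
    | zero =>
      convert equiv _ _ (Equiv.ofUnique (Fin 0 → V) Unit) _ _ unit using 1
      · ext x; simp [piWeight]
      · ext x y; simp [piKernel]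
    | succ n ih =>
      convert equiv _ _ (Fin.consEquiv fun _ => V).symm _ _ (prod _ _ _ _ _ _ h ih) using 1
      · ext x; simp [piWeight, Fin.prod_univ_succ, Fin.consEquiv, Fin.tail]
      · ext x y; simp [piKernel, Fin.prod_univ_succ, Fin.consEquiv, Fin.tail]
  convert equiv _ _ (Equiv.arrowCongr (Fintype.equivFin ι) (Equiv.refl V)) _ _
    (fin (Fintype.card ι)) using 1
  · ext x
    simp only [piWeight]
    exact Fintype.prod_equiv (Fintype.equivFin ι) _ _ fun i => by simp
  · ext x y
    simp only [piKernel]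
    exact Fintype.prod_equiv (Fintype.equivFin ι) _ _ fun i => by simp

section Tensor

variable {V : Type} [Fintype V] {m : V → ℝ} {k : V → V → ℝ}

lemma IsFiniteCoupling.unit :
    IsFiniteCoupling (fun _ : Unit => (1 : ℝ)) (fun _ _ => 1) := by
  constructor <;> simp

lemma IsFiniteCoupling.pi (h : IsFiniteCoupling m k) (ι : Type) [Fintype ι] [DecidableEq ι] :
    IsFiniteCoupling (piWeight ι m) (piKernel ι k) :=
  pi_induction (Q := fun _ _ m k => IsFiniteCoupling m k)
    (fun _ _ _ _ e _ _ h => h.comp_equiv e) .unit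
    (fun _ _ _ _ _ _ _ _ h₁ h₂ => h₁.prod h₂) m k h ι

lemma CorrelationBound.pi {ρ : ℝ} (h : IsFiniteCoupling m k) (c : CorrelationBound m k ρ)
    (ι : Type) [Fintype ι] [DecidableEq ι] :
    CorrelationBound (piWeight ι m) (piKernel ι k) ρ :=
  (pi_induction (Q := fun _ _ m k => IsFiniteCoupling m k ∧ CorrelationBound m k ρ)
    (fun _ _ _ _ e _ _ h => ⟨h.1.comp_equiv e, h.2.comp_equiv e⟩)
    ⟨.unit, fun f g => by simp [wForm, wMean]⟩
    (fun _ _ _ _ _ _ _ _ h₁ h₂ => ⟨h₁.1.prod h₂.1, h₁.2.prod h₁.1 h₂.2⟩) m k ⟨h, c⟩ ι).2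

lemma HypercontractiveBound.pi {r : ℝ} (hr : 0 < r) (h : IsFiniteCoupling m k)
    (c : HypercontractiveBound m k r) (ι : Type) [Fintype ι] [DecidableEq ι] :
    HypercontractiveBound (piWeight ι m) (piKernel ι k) r :=
  (pi_induction (Q := fun _ _ m k => IsFiniteCoupling m k ∧ HypercontractiveBound m k r)
    (fun _ _ _ _ e _ _ h => ⟨h.1.comp_equiv e, h.2.comp_equiv e⟩)
    ⟨.unit, fun f g => by
      simp only [wForm, wMean, Finset.univ_unique, Finset.sum_singleton, one_mul]
      rw [Real.sqrt_sq_eq_abs, ← Real.rpow_mul (abs_nonneg _), mul_one_div_cancel hr.ne',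
        Real.rpow_one, ← abs_mul]
      exact le_abs_self _⟩
    (fun _ _ _ _ _ _ _ _ h₁ h₂ => ⟨h₁.1.prod h₂.1, h₁.2.prod hr h₁.1 h₂.1 h₂.2⟩) m k ⟨h, c⟩ ι).2

/-- Composition of product kernels. -/
lemma piKernel_comp (ι : Type) [Fintype ι] [DecidableEq ι] {k₁ k₂ : V → V → ℝ} {c : ℝ}
    (hk : ∀ x y, c * ∑ z, k₁ x z * k₂ z y = k x y) (x y : ι → V) :
    c ^ Fintype.card ι * ∑ z, piKernel ι k₁ x z * piKernel ι k₂ z y = piKernel ι k x y := by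
  simp only [piKernel, ← Finset.prod_mul_distrib, ← hk]
  rw [Finset.prod_mul_distrib, Finset.prod_const, Finset.card_univ, Finset.prod_univ_sum,
    Fintype.piFinset_univ]

omit [Fintype V] in
lemma piWeight_const (ι : Type) [Fintype ι] (c : ℝ) (x : ι → V) :
    piWeight ι (fun _ => c) x = c ^ Fintype.card ι := by
  simp [piWeight]

end Tensor

/-! ### The symmetric two-point space -/

/-- The sign attached to a bit. -/
def bitSign (b : Bool) : ℝ := if b then 1 else -1

/-- The law of a pair of signs with correlation `θ`. -/
noncomputable def bitKernel (θ : ℝ) (x y : Bool) : ℝ := (1 + θ * (bitSign x * bitSign y)) / 4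

lemma bitKernel_symm (θ : ℝ) (x y : Bool) : bitKernel θ x y = bitKernel θ y x := by
  simp only [bitKernel, mul_comm]

lemma isFiniteCoupling_bitKernel {θ : ℝ} (hθ : |θ| ≤ 1) :
    IsFiniteCoupling (fun _ => 1 / 2) (bitKernel θ) where
  nonneg x y := by
    obtain ⟨h₁, h₂⟩ := abs_le.1 hθ
    cases x <;> cases y <;> simp [bitKernel, bitSign] <;> linarith
  sum_right x := by cases x <;> simp [bitKernel, bitSign] <;> ring
  sum_left x := by cases x <;> simp [bitKernel, bitSign] <;> ring
  sum_eq_one := by simp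

/-- On two points the covariance is `θ/4` times the product of the increments of `f` and `g`, and
each variance is a quarter of a squared increment, so this is the inequality `2xy ≤ x² + y²`. -/
lemma correlationBound_bitKernel (θ : ℝ) :
    CorrelationBound (fun _ => 1 / 2) (bitKernel θ) |θ| := by
  intro f g
  simp only [wForm, wMean, Fintype.sum_bool, bitKernel, bitSign]
  have h₁ : θ * ((f true - f false) * (g true - g false)) ≤
      |θ| * (|f true - f false| * |g true - g false|) := by
    rw [← abs_mul, ← abs_mul]; exact le_abs_self _
  have h₂ : |θ| * (2 * (|f true - f false| * |g true - g false|)) ≤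
      |θ| * ((f true - f false) ^ 2 + (g true - g false) ^ 2) := by
    refine mul_le_mul_of_nonneg_left ?_ (abs_nonneg θ)
    rw [← sq_abs (f true - f false), ← sq_abs (g true - g false)]
    nlinarith [sq_nonneg (|f true - f false| - |g true - g false|)]
  simp only [if_true, Bool.false_eq_true, if_false]
  nlinarith

/-- The semigroup law. The factor `2` is the reciprocal of the uniform weight `1/2`. -/
lemma bitKernel_comp (θ₁ θ₂ : ℝ) (x y : Bool) :
    2 * ∑ z, bitKernel θ₁ x z * bitKernel θ₂ z y = bitKernel (θ₁ * θ₂) x y := by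
  cases x <;> cases y <;> simp [bitKernel, bitSign] <;> ring

/-- With `E`, `O` the half sum and half difference of the two powers, the next moment is `(a² + c²)E
+ 2acO`. Bounding `2acO` by a multiple of `c²E` makes each step cost at most a factor `a² + (2Nc)²`.
Keeping `N` apart from `n` fixes this factor during the induction. -/
lemma two_point_even_moment (n N : ℕ) (hn : n ≤ N) (a c : ℝ) :
    ((a + c) ^ (2 * n) + (a - c) ^ (2 * n)) / 2 ≤ (a ^ 2 + (2 * N * c) ^ 2) ^ n := by
  have key : ∀ n : ℕ, (0 ≤ ((a + c) ^ (2 * n) + (a - c) ^ (2 * n)) / 2 ∧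
      0 ≤ 2 * a * c * (((a + c) ^ (2 * n) - (a - c) ^ (2 * n)) / 2)) ∧
      2 * a * c * (((a + c) ^ (2 * n) - (a - c) ^ (2 * n)) / 2) ≤
        n * (4 * c ^ 2) * (((a + c) ^ (2 * n) + (a - c) ^ (2 * n)) / 2) := by
    intro n
    induction n with
    | zero => simp
    | succ n ih =>
      obtain ⟨⟨hE, hD⟩, hDE⟩ := ih
      set E := ((a + c) ^ (2 * n) + (a - c) ^ (2 * n)) / 2 with hE'
      set O := ((a + c) ^ (2 * n) - (a - c) ^ (2 * n)) / 2 with hO'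
      have hp : (a + c) ^ (2 * n) = E + O := by rw [hE', hO']; ring
      have hm : (a - c) ^ (2 * n) = E - O := by rw [hE', hO']; ring
      have e₁ : ((a + c) ^ (2 * (n + 1)) + (a - c) ^ (2 * (n + 1))) / 2 =
          (a ^ 2 + c ^ 2) * E + 2 * a * c * O := by
        rw [mul_add, pow_add, pow_add, hp, hm]; ring
      have e₂ : 2 * a * c * (((a + c) ^ (2 * (n + 1)) - (a - c) ^ (2 * (n + 1))) / 2) =
          (a ^ 2 + c ^ 2) * (2 * a * c * O) + (2 * a * c) ^ 2 * E := by
        rw [mul_add, pow_add, pow_add, hp, hm]; ring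
      rw [e₁, e₂]
      refine ⟨⟨by positivity, by positivity⟩, ?_⟩
      push_cast
      have h₁ := mul_le_mul_of_nonneg_left hDE (show 0 ≤ a ^ 2 + c ^ 2 by positivity)
      have h₂ : 0 ≤ (n + 1 : ℝ) * (4 * c ^ 2) * (2 * a * c * O) := by positivity
      have h₃ : 0 ≤ c ^ 4 * E := by positivity
      nlinarith
  induction n with
  | zero => simp
  | succ n ih =>
    obtain ⟨⟨hE, hD⟩, hDE⟩ := key n
    have ih := ih (by omega)
    set E := ((a + c) ^ (2 * n) + (a - c) ^ (2 * n)) / 2 with hE'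
    set O := ((a + c) ^ (2 * n) - (a - c) ^ (2 * n)) / 2 with hO'
    have hp : (a + c) ^ (2 * n) = E + O := by rw [hE', hO']; ring
    have hm : (a - c) ^ (2 * n) = E - O := by rw [hE', hO']; ring
    have e₁ : ((a + c) ^ (2 * (n + 1)) + (a - c) ^ (2 * (n + 1))) / 2 =
        (a ^ 2 + c ^ 2) * E + 2 * a * c * O := by
      rw [mul_add, pow_add, pow_add, hp, hm]; ring
    rw [e₁, pow_succ]
    have hN : (n + 1 : ℝ) ≤ N := by exact_mod_cast hn
    -- This is where the scale `2N` comes from: `1 + 4n ≤ 4N²` whenever `n + 1 ≤ N`.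
    have h₁ : c ^ 2 + n * (4 * c ^ 2) ≤ (2 * N * c) ^ 2 := by
      have : 1 + n * 4 ≤ (2 * N : ℝ) ^ 2 := by nlinarith
      nlinarith [sq_nonneg c]
    calc (a ^ 2 + c ^ 2) * E + 2 * a * c * O
        ≤ E * (a ^ 2 + (c ^ 2 + n * (4 * c ^ 2))) := by linarith
      _ ≤ E * (a ^ 2 + (2 * N * c) ^ 2) := by gcongr
      _ ≤ _ := mul_le_mul_of_nonneg_right ih (by positivity)

/-- Writing `f = a ± b`, the noise operator damps the odd part to `c = b/(2n)`. Hölder with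
exponents `2n` and `r` leaves the `2n`-th moment of `a ± c`, which `two_point_even_moment` compares
with `a² + b²`. -/
lemma hypercontractiveBound_bitKernel (n : ℕ) (hn : 0 < n) {r : ℝ}
    (hr : (2 * n : ℝ).HolderConjugate r) :
    HypercontractiveBound (fun _ => 1 / 2) (bitKernel (1 / (2 * n))) r := by
  intro f g
  set a := (f true + f false) / 2 with ha
  set b := (f true - f false) / 2 with hb
  set c := b / (2 * n) with hc
  have hn' : (0 : ℝ) < n := by exact_mod_cast hn
  have hft : f true = a + b := by rw [ha, hb]; ring
  have hff : f false = a - b := by rw [ha, hb]; ring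
  have hform : wForm (bitKernel (1 / (2 * n))) f g =
      (1 / 2) * ((a + c) * g true + (a - c) * g false) := by
    simp only [wForm, Fintype.sum_bool, bitKernel, bitSign, hft, hff, hc, if_true,
      Bool.false_eq_true, if_false]
    field_simp
    ring
  have hsq : wMean (fun _ => 1 / 2) (fun x => f x ^ 2) = a ^ 2 + b ^ 2 := by
    simp only [wMean, Fintype.sum_bool, hft, hff]; ring
  have hmean : wMean (fun _ : Bool => 1 / 2) (fun x => |g x| ^ r) =
      (1 / 2) * (|g true| ^ r + |g false| ^ r) := by
    simp only [wMean, Fintype.sum_bool]; ring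
  have hH := Real.inner_le_Lp_mul_Lq Finset.univ
    (fun x : Bool => if x then a + c else a - c) g hr
  simp only [Fintype.sum_bool, if_true, Bool.false_eq_true, if_false] at hH
  have hpow : ∀ t : ℝ, |t| ^ (2 * n : ℝ) = t ^ (2 * n) := by
    intro t
    rw [show (2 * n : ℝ) = ((2 * n : ℕ) : ℝ) by push_cast; ring, Real.rpow_natCast,
      Even.pow_abs (even_two_mul n)]
  rw [hpow, hpow] at hH
  have hmom := two_point_even_moment n n le_rfl a c
  rw [show 2 * n * c = b by rw [hc]; field_simp] at hmom
  rw [hform, hsq, hmean]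
  have hA : 0 ≤ (a + c) ^ (2 * n) + (a - c) ^ (2 * n) := by
    have := (even_two_mul n).pow_nonneg (a + c)
    have := (even_two_mul n).pow_nonneg (a - c)
    positivity
  have hG : 0 ≤ |g true| ^ r + |g false| ^ r := by positivity
  -- Conjugacy lets the weight be shared between the factors, turning Hölder for sums into Hölder
  -- for means.
  have hhalf : (1 / 2 : ℝ) = (1 / 2) ^ (1 / (2 * n : ℝ)) * (1 / 2) ^ (1 / r) := by
    rw [← Real.rpow_add (by norm_num), one_div (2 * n : ℝ), one_div r, hr.inv_add_inv_eq_one,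
      Real.rpow_one]
  have hroot : ((a ^ 2 + b ^ 2) ^ n) ^ (1 / (2 * n : ℝ)) = √(a ^ 2 + b ^ 2) := by
    rw [← Real.rpow_natCast, ← Real.rpow_mul (by positivity), Real.sqrt_eq_rpow]
    congr 1
    field_simp
  calc (1 / 2) * ((a + c) * g true + (a - c) * g false)
      ≤ (1 / 2) * (((a + c) ^ (2 * n) + (a - c) ^ (2 * n)) ^ (1 / (2 * n : ℝ)) *
          (|g true| ^ r + |g false| ^ r) ^ (1 / r)) :=
        mul_le_mul_of_nonneg_left hH (by norm_num)
    _ = ((1 / 2) * ((a + c) ^ (2 * n) + (a - c) ^ (2 * n))) ^ (1 / (2 * n : ℝ)) *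
          ((1 / 2) * (|g true| ^ r + |g false| ^ r)) ^ (1 / r) := by
        rw [Real.mul_rpow (by norm_num) hA, Real.mul_rpow (by norm_num) hG]
        nth_rewrite 1 [hhalf]
        ring
    _ ≤ ((a ^ 2 + b ^ 2) ^ n) ^ (1 / (2 * n : ℝ)) *
          ((1 / 2) * (|g true| ^ r + |g false| ^ r)) ^ (1 / r) := by
        gcongr
        linarith
    _ = _ := by rw [hroot]

/-! ### The discrete cube -/

/-- Rescaling the functions in the polarized bound gives a nonnegative quadratic polynomial, whose
discriminant is the product form. Variances are enlarged to second moments on the way. -/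
lemma CorrelationBound.sq_le {V : Type*} [Fintype V] {m : V → ℝ} {k : V → V → ℝ} {ρ : ℝ}
    (hρ : 0 ≤ ρ) (h : CorrelationBound m k ρ) (hc : IsFiniteCoupling m k) (f g : V → ℝ) :
    |wForm k f g - wMean m f * wMean m g| ≤
      ρ * (√(wMean m (fun x => f x ^ 2)) * √(wMean m (fun x => g x ^ 2))) := by
  have hA : 0 ≤ wMean m (fun x => f x ^ 2) := hc.wMean_nonneg fun x => by positivity
  have hB : 0 ≤ wMean m (fun x => g x ^ 2) := hc.wMean_nonneg fun x => by positivity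
  set A := wMean m (fun x => f x ^ 2)
  set B := wMean m (fun x => g x ^ 2)
  set D := wForm k f g - wMean m f * wMean m g with hD
  have smul : ∀ s t : ℝ, 2 * (s * t * D) ≤ ρ * (s ^ 2 * A + t ^ 2 * B) := by
    intro s t
    have := h (fun x => s * f x) (fun x => t * g x)
    have l₁ : wForm k (fun x => s * f x) (fun x => t * g x) = s * t * wForm k f g := by
      simp only [wForm, Finset.mul_sum]
      exact Finset.sum_congr rfl fun _ _ => Finset.sum_congr rfl fun _ _ => by ring
    have l₂ : ∀ (u : ℝ) (w : V → ℝ), wMean m (fun x => u * w x) = u * wMean m w := by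
      intro u w
      simp only [wMean, Finset.mul_sum]
      exact Finset.sum_congr rfl fun _ _ => by ring
    simp only [mul_pow, l₁, l₂] at this
    nlinarith [mul_nonneg hρ (add_nonneg (sq_nonneg (s * wMean m f)) (sq_nonneg (t * wMean m g)))]
  have hquad : D ^ 2 ≤ ρ ^ 2 * (A * B) := by
    have := discrim_le_zero (a := ρ * A) (b := -(2 * D)) (c := ρ * B) fun s => by
      have := smul s 1
      nlinarith
    rw [discrim] at this
    nlinarith
  rw [← Real.sqrt_mul hA, ← Real.sqrt_sq hρ, ← Real.sqrt_mul (sq_nonneg _), ← Real.sqrt_sq_eq_abs]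
  exact Real.sqrt_le_sqrt hquad

lemma wForm_symm {V : Type*} [Fintype V] {k : V → V → ℝ} (hk : ∀ x y, k x y = k y x)
    (f g : V → ℝ) : wForm k f g = wForm k g f := by
  simp only [wForm]
  rw [Finset.sum_comm]
  exact Finset.sum_congr rfl fun x _ => Finset.sum_congr rfl fun y _ => by rw [hk]; ring

/-- Covariances on the cube at correlation `θ` are controlled by the `L²` and `Lʳ` norms, with
linear decay in `θ`. -/
theorem abs_cov_cube_le (n : ℕ) (hn : 0 < n) {r : ℝ} (hr : (2 * n : ℝ).HolderConjugate r)
    {θ : ℝ} (hθ : |θ| ≤ 1 / (2 * n)) (ι : Type) [Fintype ι] [DecidableEq ι]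
    (f g : (ι → Bool) → ℝ) :
    |wForm (piKernel ι (bitKernel θ)) f g -
        wMean (piWeight ι fun _ => 1 / 2) f * wMean (piWeight ι fun _ => 1 / 2) g| ≤
      2 * n * |θ| * (√(wMean (piWeight ι fun _ => 1 / 2) (fun x => f x ^ 2)) *
        wMean (piWeight ι fun _ => 1 / 2) (fun x => |g x| ^ r) ^ (1 / r)) := by
  have hn' : (1 : ℝ) ≤ n := by exact_mod_cast hn
  set ε : ℝ := 1 / (2 * n) with hε
  have hε0 : 0 < ε := by positivity
  have hε1 : |ε| ≤ 1 := by
    rw [abs_of_pos hε0, hε, div_le_one (by positivity)]; linarith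
  set m := piWeight ι (fun _ : Bool => (1 / 2 : ℝ)) with hm
  have hmc : ∀ x, m x = (1 / 2) ^ Fintype.card ι := fun x => piWeight_const ι _ x
  -- The smallness of `θ` is needed here: `θ = (θ/ε)·ε` must be a product of two admissible
  -- correlations.
  have hθ' : |θ / ε| ≤ 1 := by
    rw [abs_div, abs_of_pos hε0, div_le_one hε0]; exact hθ
  have c₁ := (isFiniteCoupling_bitKernel hθ').pi ι
  have c₂ := (isFiniteCoupling_bitKernel hε1).pi ι
  have b₁ := (correlationBound_bitKernel (θ / ε)).pi (isFiniteCoupling_bitKernel hθ') ι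
  have b₂ := (hypercontractiveBound_bitKernel n hn hr).pi hr.symm.pos
    (isFiniteCoupling_bitKernel hε1) ι
  rw [← hm] at c₁ c₂ b₁ b₂
  have hcomp : ∀ x y, 2 ^ Fintype.card ι * ∑ z, piKernel ι (bitKernel (θ / ε)) x z *
      piKernel ι (bitKernel ε) z y = piKernel ι (bitKernel θ) x y := by
    refine piKernel_comp ι fun x y => ?_
    rw [bitKernel_comp, div_mul_cancel₀ _ hε0.ne']
  -- `h = T_ε g`, normalized by the uniform weight; it has the same mean as `g`.
  set h : (ι → Bool) → ℝ := fun z => 2 ^ Fintype.card ι * ∑ y, piKernel ι (bitKernel ε) z y * g y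
    with hh
  have hmh : ∀ z, m z * h z = ∑ y, piKernel ι (bitKernel ε) z y * g y := by
    intro z
    rw [hmc, hh, ← mul_assoc, ← mul_pow]
    norm_num
  have hmean : wMean m h = wMean m g := by
    rw [← c₂.sum_sum_right g, wMean]
    exact Finset.sum_congr rfl fun z _ => hmh z
  have hform : wForm (piKernel ι (bitKernel θ)) f g = wForm (piKernel ι (bitKernel (θ / ε))) f h := by
    simp only [wForm, ← hcomp, hh, Finset.mul_sum, Finset.sum_mul]
    refine Finset.sum_congr rfl fun x _ => ?_
    rw [Finset.sum_comm]
    exact Finset.sum_congr rfl fun _ _ => Finset.sum_congr rfl fun _ _ => by ring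
  have hsq : wMean m (fun z => h z ^ 2) = wForm (piKernel ι (bitKernel ε)) h g := by
    simp only [wMean, wForm]
    refine Finset.sum_congr rfl fun z _ => ?_
    rw [pow_two, mul_left_comm, hmh, Finset.mul_sum]
    exact Finset.sum_congr rfl fun _ _ => by ring
  -- Duality: testing the form bound with `h` itself gives `‖h‖₂² ≤ ‖h‖₂ ‖g‖ᵣ`, and one factor
  -- cancels unless it vanishes.
  have hcontr : √(wMean m (fun z => h z ^ 2)) ≤ wMean m (fun x => |g x| ^ r) ^ (1 / r) := by
    have hb := b₂ h g
    have h0 : 0 ≤ wMean m (fun z => h z ^ 2) := c₁.wMean_nonneg fun z => by positivity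
    have hg0 : 0 ≤ wMean m (fun x => |g x| ^ r) ^ (1 / r) :=
      Real.rpow_nonneg (c₁.wMean_nonneg fun z => by positivity) _
    rw [← hsq] at hb
    nth_rewrite 1 [← Real.mul_self_sqrt h0] at hb
    rcases (Real.sqrt_nonneg (wMean m (fun z => h z ^ 2))).eq_or_lt with h1 | h1
    · rw [← h1]; exact hg0
    · exact le_of_mul_le_mul_left hb h1
  rw [hform, ← hmean]
  refine (b₁.sq_le (abs_nonneg _) c₁ f h).trans ?_
  rw [abs_div, abs_of_pos hε0, show |θ| / ε = 2 * n * |θ| by rw [hε]; field_simp]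
  gcongr

/-! ### A central limit theorem for correlated signs -/

open Filter Topology

/-- The law of `X` under the finite coupling `k`. -/
noncomputable def pairLaw {V E : Type*} [Fintype V] [MeasurableSpace E] (k : V → V → ℝ)
    (X : V → V → E) : Measure E :=
  ∑ x, ∑ y, ENNReal.ofReal (k x y) • Measure.dirac (X x y)

section PairLaw

variable {V E : Type*} [Fintype V] [MeasurableSpace E] {m : V → ℝ} {k : V → V → ℝ}

lemma isProbabilityMeasure_pairLaw (h : IsFiniteCoupling m k) (X : V → V → E) :
    IsProbabilityMeasure (pairLaw k X) := by
  constructor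
  simp only [pairLaw, Measure.coe_finsetSum, Finset.sum_apply, Measure.smul_apply,
    Measure.dirac_apply_of_mem (Set.mem_univ _), smul_eq_mul, mul_one]
  rw [Finset.sum_congr rfl fun x _ => (ENNReal.ofReal_sum_of_nonneg fun y _ => h.nonneg x y).symm,
    ← ENNReal.ofReal_sum_of_nonneg fun x _ => Finset.sum_nonneg fun y _ => h.nonneg x y]
  simp [h.sum_right, h.sum_eq_one]

lemma integral_pairLaw [MeasurableSingletonClass E] {F : Type*} [NormedAddCommGroup F]
    [NormedSpace ℝ F] [CompleteSpace F] (h : IsFiniteCoupling m k) (X : V → V → E) (φ : E → F) :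
    ∫ z, φ z ∂(pairLaw k X) = ∑ x, ∑ y, k x y • φ (X x y) := by
  have hint : ∀ x y, Integrable φ (ENNReal.ofReal (k x y) • Measure.dirac (X x y)) := fun x y =>
    (integrable_dirac enorm_lt_top).smul_measure ENNReal.ofReal_ne_top
  rw [pairLaw, integral_finsetSum_measure fun x _ =>
    integrable_finsetSum_measure.2 fun y _ => hint x y]
  refine Finset.sum_congr rfl fun x _ => ?_
  rw [integral_finsetSum_measure fun y _ => hint x y]
  refine Finset.sum_congr rfl fun y _ => ?_
  rw [integral_smul_measure, integral_dirac, ENNReal.toReal_ofReal (h.nonneg x y)]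

end PairLaw

lemma sum_sum_prod_pi {ι V R : Type*} [Fintype ι] [DecidableEq ι] [Fintype V] [CommSemiring R]
    (G : ι → V → V → R) :
    ∑ x : ι → V, ∑ y : ι → V, ∏ i, G i (x i) (y i) = ∏ i, ∑ a, ∑ b, G i a b := by
  rw [Finset.prod_univ_sum, Fintype.piFinset_univ]
  refine Finset.sum_congr rfl fun x _ => ?_
  rw [Finset.prod_univ_sum, Fintype.piFinset_univ]

/-- Since `1 - cos t = (t²/2) sinc(t/2)²`, the claim is continuity of `sinc` at `0`, with no
separate treatment of `c = 0`. -/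
lemma tendsto_mul_cos_div_sqrt_sub_one (c : ℝ) :
    Tendsto (fun n : ℕ => n * (Real.cos (c / √n) - 1)) atTop (𝓝 (-(c ^ 2) / 2)) := by
  have h₀ : Tendsto (fun n : ℕ => c / √(n : ℝ)) atTop (𝓝 0) :=
    tendsto_const_nhds.div_atTop (Real.tendsto_sqrt_atTop.comp tendsto_natCast_atTop_atTop)
  have h₁ : Tendsto (fun n : ℕ => -(c ^ 2) / 2 * Real.sinc (c / √(n : ℝ) / 2) ^ 2) atTop
      (𝓝 (-(c ^ 2) / 2 * Real.sinc (0 / 2) ^ 2)) :=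
    (((Real.continuous_sinc.tendsto _).comp (h₀.div_const 2)).pow 2).const_mul _
  simp only [zero_div, Real.sinc_zero, one_pow, mul_one] at h₁
  refine h₁.congr' ?_
  filter_upwards [eventually_gt_atTop 0] with n hn
  have hn' : (0 : ℝ) < n := by exact_mod_cast hn
  set t := c / √(n : ℝ) with ht
  have hct : c ^ 2 = n * t ^ 2 := by
    rw [ht, div_pow, Real.sq_sqrt hn'.le]; field_simp
  have hs : t / 2 * Real.sinc (t / 2) = Real.sin (t / 2) := by
    by_cases h : t / 2 = 0
    · simp [h]
    · rw [Real.sinc_of_ne_zero h, mul_div_cancel₀ _ h]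
  have hcos : Real.cos t = 1 - 2 * Real.sin (t / 2) ^ 2 := by
    have := Real.cos_sq_add_sin_sq (t / 2)
    have h2 := Real.cos_two_mul (t / 2)
    rw [mul_div_cancel₀ t two_ne_zero] at h2
    rw [h2]; linarith
  rw [hcos, ← hs, hct]
  ring

/-- The characteristic function of a pair of correlated signs. -/
lemma sum_bitKernel_mul_exp (θ s t : ℝ) :
    ∑ a, ∑ b, (bitKernel θ a b : ℂ) * Complex.exp (((bitSign a * s + bitSign b * t : ℝ) : ℂ) *
      Complex.I) =
    (((1 + θ) / 2 * Real.cos (s + t) + (1 - θ) / 2 * Real.cos (s - t) : ℝ) : ℂ) := by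
  simp only [Fintype.sum_bool, bitKernel, bitSign, if_true, Bool.false_eq_true, if_false]
  push_cast [Complex.cos]
  ring_nf

lemma tendsto_charFun_bitKernel_pow (θ s t : ℝ) :
    Tendsto (fun n : ℕ => (∑ a, ∑ b, (bitKernel θ a b : ℂ) *
      Complex.exp (((bitSign a * (s / √n) + bitSign b * (t / √n) : ℝ) : ℂ) * Complex.I)) ^ n)
      atTop (𝓝 (Real.exp (-(s ^ 2 + t ^ 2 + 2 * θ * (s * t)) / 2) : ℝ)) := by
  simp only [sum_bitKernel_mul_exp, ← Complex.ofReal_pow]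
  refine (Complex.continuous_ofReal.tendsto _).comp ?_
  have h := ((tendsto_mul_cos_div_sqrt_sub_one (s + t)).const_mul ((1 + θ) / 2)).add
    ((tendsto_mul_cos_div_sqrt_sub_one (s - t)).const_mul ((1 - θ) / 2))
  have h' := Real.tendsto_one_add_pow_exp_of_tendsto (g := fun n : ℕ =>
    (1 + θ) / 2 * Real.cos (s / √n + t / √n) + (1 - θ) / 2 * Real.cos (s / √n - t / √n) - 1)
    (t := -(s ^ 2 + t ^ 2 + 2 * θ * (s * t)) / 2) ?_
  · simpa using h'
  -- The limits agree by `(1+θ)/2·(s+t)² + (1-θ)/2·(s-t)² = s² + t² + 2θst`.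
  · convert h using 2 with n
    · rw [← add_div, ← sub_div]; ring
    · ring

/-- Normalized sums of linear combinations of correlated signs. -/
noncomputable def signSum {J : Type*} {d : ℕ} (a : J → Fin d → ℝ) (n : ℕ)
    (x y : Fin n × Fin d → Bool) : EuclideanSpace ℝ (J ⊕ J) :=
  WithLp.toLp 2 (Sum.elim (fun j => ∑ i, bitSign (x i) * (a j i.2 / √n))
    (fun j => ∑ i, bitSign (y i) * (a j i.2 / √n)))

/-- The sign pairs are independent over the index set `Fin n × Fin d`, so the characteristic
function factors, with `n` equal factors for each `l`. -/
lemma charFun_pairLaw_signSum {J : Type*} [Fintype J] {d : ℕ} (a : J → Fin d → ℝ) {θ : ℝ}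
    (hθ : |θ| ≤ 1) (n : ℕ) (t : EuclideanSpace ℝ (J ⊕ J)) :
    charFun (pairLaw (piKernel (Fin n × Fin d) (bitKernel θ)) (signSum a n)) t =
      ∏ l, (∑ b, ∑ c, (bitKernel θ b c : ℂ) *
        Complex.exp (((bitSign b * ((∑ j, t (Sum.inl j) * a j l) / √n) +
          bitSign c * ((∑ j, t (Sum.inr j) * a j l) / √n) : ℝ) : ℂ) * Complex.I)) ^ n := by
  rw [charFun_apply, integral_pairLaw ((isFiniteCoupling_bitKernel hθ).pi _)]
  have hinner : ∀ x y, inner ℝ (signSum a n x y) t =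
      ∑ i : Fin n × Fin d, (bitSign (x i) * ((∑ j, t (Sum.inl j) * a j i.2) / √n) +
        bitSign (y i) * ((∑ j, t (Sum.inr j) * a j i.2) / √n)) := by
    intro x y
    simp only [PiLp.inner_apply, signSum, Fintype.sum_sum_type, Sum.elim_inl, Sum.elim_inr,
      RCLike.inner_apply, conj_trivial, Finset.mul_sum, Finset.sum_div, Finset.sum_add_distrib]
    congr 1
    · rw [Finset.sum_comm]
      exact Finset.sum_congr rfl fun _ _ => Finset.sum_congr rfl fun _ _ => by ring
    · rw [Finset.sum_comm]
      exact Finset.sum_congr rfl fun _ _ => Finset.sum_congr rfl fun _ _ => by ring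
  have hterm : ∀ x y, piKernel (Fin n × Fin d) (bitKernel θ) x y •
      Complex.exp ((inner ℝ (signSum a n x y) t : ℝ) * Complex.I) =
      ∏ i : Fin n × Fin d, ((bitKernel θ (x i) (y i) : ℂ) *
        Complex.exp (((bitSign (x i) * ((∑ j, t (Sum.inl j) * a j i.2) / √n) +
          bitSign (y i) * ((∑ j, t (Sum.inr j) * a j i.2) / √n) : ℝ) : ℂ) * Complex.I)) := by
    intro x y
    rw [hinner, Complex.ofReal_sum, Finset.sum_mul, Complex.exp_sum, Finset.prod_mul_distrib,
      piKernel, ← Complex.ofReal_prod, Complex.real_smul]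
  simp only [hterm]
  rw [sum_sum_prod_pi (fun (i : Fin n × Fin d) b c => (bitKernel θ b c : ℂ) *
        Complex.exp (((bitSign b * ((∑ j, t (Sum.inl j) * a j i.2) / √n) +
          bitSign c * ((∑ j, t (Sum.inr j) * a j i.2) / √n) : ℝ) : ℂ) * Complex.I)),
    Fintype.prod_prod_type]
  simp only [Finset.prod_const, Finset.card_univ, Fintype.card_fin, Finset.prod_pow]

/-- The covariance estimate for a centred Gaussian pair of vectors with cross-covariance `θ` times
the common covariance. -/
theorem abs_cov_le_of_charFun {J : Type*} [Fintype J] {d : ℕ} (a : J → Fin d → ℝ)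
    (N : ℕ) (hN : 0 < N) {r : ℝ} (hr : (2 * N : ℝ).HolderConjugate r)
    {θ : ℝ} (hθ : |θ| ≤ 1 / (2 * N)) (ν : Measure (EuclideanSpace ℝ (J ⊕ J)))
    [IsProbabilityMeasure ν]
    (hν : ∀ t : EuclideanSpace ℝ (J ⊕ J), charFun ν t = (Real.exp (-(∑ l,
      ((∑ j, t (Sum.inl j) * a j l) ^ 2 + (∑ j, t (Sum.inr j) * a j l) ^ 2 +
        2 * θ * ((∑ j, t (Sum.inl j) * a j l) * ∑ j, t (Sum.inr j) * a j l))) / 2) : ℝ))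
    (f g : BoundedContinuousFunction (J → ℝ) ℝ) :
    |∫ z, f (fun j => z (Sum.inl j)) * g (fun j => z (Sum.inr j)) ∂ν -
        (∫ z, f (fun j => z (Sum.inl j)) ∂ν) * ∫ z, g (fun j => z (Sum.inr j)) ∂ν| ≤
      2 * N * |θ| * (√(∫ z, f (fun j => z (Sum.inl j)) ^ 2 ∂ν) *
        (∫ z, |g (fun j => z (Sum.inr j))| ^ r ∂ν) ^ (1 / r)) ∧
    |∫ z, f (fun j => z (Sum.inl j)) * g (fun j => z (Sum.inr j)) ∂ν -
        (∫ z, f (fun j => z (Sum.inl j)) ∂ν) * ∫ z, g (fun j => z (Sum.inr j)) ∂ν| ≤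
      2 * N * |θ| * (√(∫ z, g (fun j => z (Sum.inr j)) ^ 2 ∂ν) *
        (∫ z, |f (fun j => z (Sum.inl j))| ^ r ∂ν) ^ (1 / r)) := by
  have hN' : (1 : ℝ) ≤ N := by exact_mod_cast hN
  have hθ1 : |θ| ≤ 1 := hθ.trans (by rw [div_le_one (by positivity)]; linarith)
  have hr0 : 0 < r := hr.symm.pos
  have hcp := fun n : ℕ => (isFiniteCoupling_bitKernel hθ1).pi (Fin n × Fin d)
  let μ : ℕ → ProbabilityMeasure (EuclideanSpace ℝ (J ⊕ J)) := fun n =>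
    ⟨pairLaw (piKernel (Fin n × Fin d) (bitKernel θ)) (signSum a n),
      isProbabilityMeasure_pairLaw (hcp n) _⟩
  let ν' : ProbabilityMeasure (EuclideanSpace ℝ (J ⊕ J)) := ⟨ν, inferInstance⟩
  -- Lévy's continuity theorem: the normalized sign sums converge weakly to `ν`.
  have hlim : Tendsto μ atTop (𝓝 ν') := by
    refine ProbabilityMeasure.tendsto_of_tendsto_charFun fun t => ?_
    simp only [μ, ν', ProbabilityMeasure.coe_mk, charFun_pairLaw_signSum a hθ1, hν]
    rw [← Finset.sum_neg_distrib, Finset.sum_div, Real.exp_sum, Complex.ofReal_prod]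
    exact tendsto_finsetProd _ fun l _ => tendsto_charFun_bitKernel_pow θ _ _
  have hlim := ProbabilityMeasure.tendsto_iff_forall_integral_tendsto.1 hlim
  have hcont : ∀ φ : EuclideanSpace ℝ (J ⊕ J) → ℝ, Continuous φ → (∃ C, ∀ z, |φ z| ≤ C) →
      Tendsto (fun n => ∑ x, ∑ y, piKernel (Fin n × Fin d) (bitKernel θ) x y *
        φ (signSum a n x y)) atTop (𝓝 (∫ z, φ z ∂ν)) := by
    rintro φ hφ ⟨C, hC⟩
    have := hlim (BoundedContinuousFunction.ofNormedAddCommGroup φ hφ C hC)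
    simpa only [μ, ν', ProbabilityMeasure.coe_mk, integral_pairLaw (hcp _),
      BoundedContinuousFunction.coe_ofNormedAddCommGroup, smul_eq_mul] using this
  obtain ⟨Cf, hCf⟩ : ∃ C, ∀ z, |f z| ≤ C := ⟨‖f‖, fun z => f.norm_coe_le_norm z⟩
  obtain ⟨Cg, hCg⟩ : ∃ C, ∀ z, |g z| ≤ C := ⟨‖g‖, fun z => g.norm_coe_le_norm z⟩
  have hfc : Continuous fun z : EuclideanSpace ℝ (J ⊕ J) => f (fun j => z (Sum.inl j)) :=
    f.continuous.comp (by fun_prop)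
  have hgc : Continuous fun z : EuclideanSpace ℝ (J ⊕ J) => g (fun j => z (Sum.inr j)) :=
    g.continuous.comp (by fun_prop)
  have tfg := hcont (fun z => f (fun j => z (Sum.inl j)) * g (fun j => z (Sum.inr j)))
    (hfc.mul hgc) ⟨Cf * Cg, fun z => by
    rw [abs_mul]
    exact mul_le_mul (hCf _) (hCg _) (abs_nonneg _) ((abs_nonneg _).trans (hCf 0))⟩
  have tf := hcont _ hfc ⟨Cf, fun z => hCf _⟩
  have tg := hcont _ hgc ⟨Cg, fun z => hCg _⟩
  have tf2 := hcont (fun z => f (fun j => z (Sum.inl j)) ^ 2) (hfc.pow 2) ⟨Cf ^ 2, fun z => by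
    rw [abs_pow]; exact pow_le_pow_left₀ (abs_nonneg _) (hCf _) 2⟩
  have tg2 := hcont (fun z => g (fun j => z (Sum.inr j)) ^ 2) (hgc.pow 2) ⟨Cg ^ 2, fun z => by
    rw [abs_pow]; exact pow_le_pow_left₀ (abs_nonneg _) (hCg _) 2⟩
  have tfr := hcont _ (hfc.abs.rpow_const fun _ => Or.inr hr0.le) ⟨Cf ^ r, fun z => by
    rw [abs_of_nonneg (by positivity)]
    exact Real.rpow_le_rpow (abs_nonneg _) (hCf _) hr0.le⟩
  have tgr := hcont _ (hgc.abs.rpow_const fun _ => Or.inr hr0.le) ⟨Cg ^ r, fun z => by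
    rw [abs_of_nonneg (by positivity)]
    exact Real.rpow_le_rpow (abs_nonneg _) (hCg _) hr0.le⟩
  -- Each half of `signSum` depends on only one of the two cube points, so one-sided integrals
  -- reduce to weighted means.
  let X : (n : ℕ) → (Fin n × Fin d → Bool) → J → ℝ := fun n x j =>
    ∑ i, bitSign (x i) * (a j i.2 / √n)
  have hl : ∀ n x y, (fun j => signSum a n x y (Sum.inl j)) = X n x := fun _ _ _ => rfl
  have hr' : ∀ n x y, (fun j => signSum a n x y (Sum.inr j)) = X n y := fun _ _ _ => rfl
  simp only [hl, hr'] at tfg tf tg tf2 tg2 tfr tgr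
  have sL := fun (n : ℕ) (φ : (J → ℝ) → ℝ) => (hcp n).sum_sum_left fun x => φ (X n x)
  have sR := fun (n : ℕ) (φ : (J → ℝ) → ℝ) => (hcp n).sum_sum_right fun x => φ (X n x)
  simp only [fun n => sL n f, fun n => sR n g, fun n => sL n (fun z => f z ^ 2),
    fun n => sR n (fun z => g z ^ 2), fun n => sL n (fun z => |f z| ^ r),
    fun n => sR n (fun z => |g z| ^ r)] at tf tg tf2 tg2 tfr tgr
  have hroot : 0 ≤ 1 / r := by positivity
  constructor
  · refine le_of_tendsto_of_tendsto (tfg.sub (tf.mul tg)).abs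
      ((tf2.sqrt.mul (tgr.rpow_const (Or.inr hroot))).const_mul _)
      (Eventually.of_forall fun n => ?_)
    exact abs_cov_cube_le N hN hr hθ (Fin n × Fin d) (fun x => f (X n x)) (fun x => g (X n x))
  · refine le_of_tendsto_of_tendsto (tfg.sub (tf.mul tg)).abs
      ((tg2.sqrt.mul (tfr.rpow_const (Or.inr hroot))).const_mul _)
      (Eventually.of_forall fun n => ?_)
    -- The norms change roles by symmetry of the kernel.
    have := abs_cov_cube_le N hN hr hθ (Fin n × Fin d) (fun x => g (X n x)) (fun x => f (X n x))
    rwa [wForm_symm (fun x y => by simp only [piKernel, bitKernel_symm θ (x _)]),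
      mul_comm (wMean _ fun x => g (X n x))] at this

/-! ### Isonormal processes -/

section Isonormal

variable {H : Type u} [NormedAddCommGroup H] [InnerProductSpace ℝ H] {Ω : Type v}
  [MeasurableSpace Ω] {P : Measure Ω} {W What : H → Ω → ℝ} {J : Type*} [Fintype J]

lemma IsIsonormalProcess.hasGaussianLaw_sum (hW : IsIsonormalProcess W P) (h : J → H)
    (c : J → ℝ) : HasGaussianLaw (fun ω => ∑ j, c j * W (h j) ω) P :=
  ((hW.isGaussianProcess.comp_right h).smul c).hasGaussianLaw_fun_sum (I := Finset.univ)

lemma IsIsonormalProcess.integral_sum_sq (hW : IsIsonormalProcess W P) (h : J → H)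
    (c : J → ℝ) : ∫ ω, (∑ j, c j * W (h j) ω) ^ 2 ∂P = ‖∑ j, c j • h j‖ ^ 2 := by
  have hint : ∀ i j, Integrable (fun ω => c i * W (h i) ω * (c j * W (h j) ω)) P := fun i j =>
    ((hW.isGaussianProcess.hasGaussianLaw_eval _).memLp_two.const_mul _).integrable_mul
      ((hW.isGaussianProcess.hasGaussianLaw_eval _).memLp_two.const_mul _)
  simp only [pow_two, Finset.sum_mul_sum]
  rw [integral_finsetSum _ fun i _ => integrable_finsetSum _ fun j _ => hint i j,
    ← pow_two, ← real_inner_self_eq_norm_sq, sum_inner]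
  refine Finset.sum_congr rfl fun i _ => ?_
  rw [integral_finsetSum _ fun j _ => hint i j, inner_sum]
  refine Finset.sum_congr rfl fun j _ => ?_
  rw [show (fun ω => c i * W (h i) ω * (c j * W (h j) ω)) =
      fun ω => c i * c j * (W (h i) ω * W (h j) ω) from funext fun ω => mul_mul_mul_comm _ _ _ _,
    integral_const_mul, hW.covariance, real_inner_smul_left, real_inner_smul_right, mul_assoc]

lemma IsIsonormalProcess.measurable_sum (hW : IsIsonormalProcess W P) (h : J → H)
    (c : J → ℝ) : Measurable fun ω => ∑ j, c j * W (h j) ω :=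
  Finset.measurable_sum _ fun j _ => (hW.measurable (h j)).const_mul _

lemma IsIsonormalProcess.charFun_sum (hW : IsIsonormalProcess W P) (h : J → H) (c : J → ℝ) :
    charFun (P.map fun ω => ∑ j, c j * W (h j) ω) 1 =
      (Real.exp (-‖∑ j, c j • h j‖ ^ 2 / 2) : ℝ) := by
  have hmean : ∫ ω, ∑ j, c j * W (h j) ω ∂P = 0 := by
    rw [integral_finsetSum _ fun j _ =>
      (hW.isGaussianProcess.hasGaussianLaw_eval _).integrable.const_mul _]
    simp [integral_const_mul, hW.centered]
  rw [(hW.hasGaussianLaw_sum h c).charFun_map_eq]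
  simp only [RCLike.inner_apply, conj_trivial, mul_one]
  rw [variance_of_integral_eq_zero (hW.measurable_sum h c).aemeasurable hmean, hmean,
    hW.integral_sum_sq h c]
  push_cast
  congr 1
  ring

/-- Regrouping gives a `W`-part with coefficients `s + θt` and an independent `What`-part with
coefficients `√(1-θ²) t`. Arbitrary `s`, `t` determine the joint law of the pair of vectors. -/
lemma charFun_correlated_isonormal [IsProbabilityMeasure P] (hW : IsIsonormalProcess W P)
    (hWhat : IsIsonormalProcess What P)
    (hind : IndepFun (fun ω h => W h ω) (fun ω h => What h ω) P) {θ : ℝ}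
    (hθ : θ ∈ Set.Icc (-1 : ℝ) 1) (h : J → H) (s t : J → ℝ) :
    charFun (P.map fun ω => ∑ j, s j * W (h j) ω +
        ∑ j, t j * (θ * W (h j) ω + √(1 - θ ^ 2) * What (h j) ω)) 1 =
      (Real.exp (-(‖∑ j, (s j + θ * t j) • h j‖ ^ 2 +
        (1 - θ ^ 2) * ‖∑ j, t j • h j‖ ^ 2) / 2) : ℝ) := by
  have hnn : 0 ≤ 1 - θ ^ 2 := by nlinarith [hθ.1, hθ.2]
  have hsplit : (fun ω => ∑ j, s j * W (h j) ω +
        ∑ j, t j * (θ * W (h j) ω + √(1 - θ ^ 2) * What (h j) ω)) =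
      fun ω => (∑ j, (s j + θ * t j) * W (h j) ω) +
        ∑ j, (√(1 - θ ^ 2) * t j) * What (h j) ω := by
    ext ω
    rw [← Finset.sum_add_distrib, ← Finset.sum_add_distrib]
    exact Finset.sum_congr rfl fun j _ => by ring
  have hsum : ∀ c : J → ℝ, Measurable fun x : H → ℝ => ∑ j, c j * x (h j) := fun c =>
    Finset.measurable_sum _ fun j _ => (measurable_pi_apply _).const_mul _
  have hAB : IndepFun (fun ω => ∑ j, (s j + θ * t j) * W (h j) ω)
      (fun ω => ∑ j, (√(1 - θ ^ 2) * t j) * What (h j) ω) P :=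
    hind.comp (hsum fun j => s j + θ * t j) (hsum fun j => √(1 - θ ^ 2) * t j)
  rw [hsplit, hAB.charFun_map_fun_add_eq_mul (hW.measurable_sum h _).aemeasurable
    (hWhat.measurable_sum h _).aemeasurable, Pi.mul_apply, hW.charFun_sum h, hWhat.charFun_sum h,
    ← Complex.ofReal_mul, ← Real.exp_add]
  simp only [mul_smul]
  rw [← Finset.smul_sum, norm_smul, mul_pow, Real.norm_eq_abs, sq_abs, Real.sq_sqrt hnn]
  congr 2
  ring

/-- The process `θ W + √(1 - θ²) What` has the same law as `W`. -/
lemma map_correlated_isonormal [IsProbabilityMeasure P] (hW : IsIsonormalProcess W P)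
    (hWhat : IsIsonormalProcess What P)
    (hind : IndepFun (fun ω h => W h ω) (fun ω h => What h ω) P) {θ : ℝ}
    (hθ : θ ∈ Set.Icc (-1 : ℝ) 1) :
    P.map (fun ω h => W h ω) = P.map (fun ω h => θ * W h ω + √(1 - θ ^ 2) * What h ω) := by
  have hYm : ∀ h, Measurable fun ω => θ * W h ω + √(1 - θ ^ 2) * What h ω := fun h =>
    ((hW.measurable h).const_mul _).add ((hWhat.measurable h).const_mul _)
  refine (map_eq_iff_forall_finset_map_restrict_eq (X := W)
    (Y := fun h ω => θ * W h ω + √(1 - θ ^ 2) * What h ω)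
    (measurable_pi_lambda _ hW.measurable).aemeasurable
    (measurable_pi_lambda _ hYm).aemeasurable).2 fun I => ?_
  have h₁ : Measurable fun ω => I.restrict fun h => W h ω :=
    measurable_pi_lambda _ fun _ => hW.measurable _
  have h₂ : Measurable fun ω => I.restrict fun h => θ * W h ω + √(1 - θ ^ 2) * What h ω :=
    measurable_pi_lambda _ fun _ => hYm _
  have := Measure.isProbabilityMeasure_map (μ := P) h₁.aemeasurable
  have := Measure.isProbabilityMeasure_map (μ := P) h₂.aemeasurable
  refine Measure.ext_of_charFunDual (funext fun L => ?_)
  classical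
  have hL : ∀ x : I → ℝ, L x = ∑ j, L (Pi.single j 1) * x j := fun x => by
    conv_lhs => rw [← Finset.univ_sum_single x]
    rw [map_sum]
    refine Finset.sum_congr rfl fun j _ => ?_
    rw [show (Pi.single j (x j) : I → ℝ) = x j • Pi.single j 1 by
      rw [← Pi.single_smul]; simp, map_smul, smul_eq_mul, mul_comm]
  rw [charFunDual_eq_charFun_map_one, charFunDual_eq_charFun_map_one,
    Measure.map_map (by fun_prop) h₁, Measure.map_map (by fun_prop) h₂]
  -- Setting `t = 0` or `s = 0` isolates each process; the exponents agree since `θ² + (1 - θ²) =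
  -- 1`.
  have e₁ := charFun_correlated_isonormal hW hWhat hind hθ (fun j : I => (j : H))
    (fun j => L (Pi.single j 1)) 0
  have e₂ := charFun_correlated_isonormal hW hWhat hind hθ (fun j : I => (j : H)) 0
    (fun j => L (Pi.single j 1))
  have c₁ : (⇑L ∘ fun ω => I.restrict fun h => W h ω) =
      fun ω => ∑ j : I, L (Pi.single j 1) * W j ω := by
    ext ω; exact hL _
  have c₂ : (⇑L ∘ fun ω => I.restrict fun h => θ * W h ω + √(1 - θ ^ 2) * What h ω) =
      fun ω => ∑ j : I, L (Pi.single j 1) * (θ * W j ω + √(1 - θ ^ 2) * What j ω) := by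
    ext ω; exact hL _
  rw [c₁, c₂]
  simp only [Pi.zero_apply, zero_mul, mul_zero, add_zero, zero_add, Finset.sum_const_zero,
    zero_smul, norm_zero] at e₁ e₂
  rw [e₁, e₂]
  simp only [mul_smul, ← Finset.smul_sum, norm_smul, mul_pow, Real.norm_eq_abs, sq_abs]
  congr 2
  ring

/-- Coordinates in an orthonormal basis of the finite-dimensional span; these are the coefficients
used in `signSum`. -/
lemma exists_gram_coordinates (h : J → H) : ∃ (d : ℕ) (a : J → Fin d → ℝ),
    ∀ c : J → ℝ, ‖∑ j, c j • h j‖ ^ 2 = ∑ l, (∑ j, c j * a j l) ^ 2 := by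
  let V := Submodule.span ℝ (Set.range h)
  have : FiniteDimensional ℝ V := FiniteDimensional.span_of_finite ℝ (Set.finite_range h)
  let b := stdOrthonormalBasis ℝ V
  let h' : J → V := fun j => ⟨h j, Submodule.subset_span ⟨j, rfl⟩⟩
  refine ⟨_, fun j l => inner ℝ (b l) (h' j), fun c => ?_⟩
  have e : ‖∑ j, c j • h j‖ = ‖∑ j, c j • h' j‖ := by
    rw [Submodule.coe_norm]; simp [h']
  rw [e, ← b.sum_sq_norm_inner_right]
  refine Finset.sum_congr rfl fun l _ => ?_
  rw [inner_sum, Real.norm_eq_abs, sq_abs]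
  simp only [real_inner_smul_right]

/-- The covariance estimate for bounded continuous functions of finitely many coordinates. -/
theorem abs_cov_le_of_boundedContinuous [IsProbabilityMeasure P] (hW : IsIsonormalProcess W P)
    (hWhat : IsIsonormalProcess What P)
    (hind : IndepFun (fun ω h => W h ω) (fun ω h => What h ω) P)
    (N : ℕ) (hN : 0 < N) {r : ℝ} (hr : (2 * N : ℝ).HolderConjugate r)
    {θ : ℝ} (hθ : |θ| ≤ 1 / (2 * N)) (h : J → H) (f g : BoundedContinuousFunction (J → ℝ) ℝ)
    {F G : Ω → ℝ} (hF : F = fun ω => f fun j => W (h j) ω)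
    (hG : G = fun ω => g fun j => θ * W (h j) ω + √(1 - θ ^ 2) * What (h j) ω) :
    |∫ ω, F ω * G ω ∂P - (∫ ω, F ω ∂P) * ∫ ω, G ω ∂P| ≤
      2 * N * |θ| * (√(∫ ω, F ω ^ 2 ∂P) * (∫ ω, |G ω| ^ r ∂P) ^ (1 / r)) ∧
    |∫ ω, F ω * G ω ∂P - (∫ ω, F ω ∂P) * ∫ ω, G ω ∂P| ≤
      2 * N * |θ| * (√(∫ ω, G ω ^ 2 ∂P) * (∫ ω, |F ω| ^ r ∂P) ^ (1 / r)) := by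
  have hN' : (1 : ℝ) ≤ N := by exact_mod_cast hN
  have hθ1 : |θ| ≤ 1 := hθ.trans (by rw [div_le_one (by positivity)]; linarith)
  have hθI : θ ∈ Set.Icc (-1 : ℝ) 1 := abs_le.1 hθ1
  obtain ⟨d, a, ha⟩ := exists_gram_coordinates h
  let Z : Ω → EuclideanSpace ℝ (J ⊕ J) := fun ω => WithLp.toLp 2 (Sum.elim
    (fun j => W (h j) ω) (fun j => θ * W (h j) ω + √(1 - θ ^ 2) * What (h j) ω))
  have hZ : Measurable Z := by
    refine (WithLp.measurable_toLp 2 _).comp (measurable_pi_lambda _ fun i => ?_)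
    cases i with
    | inl j => exact hW.measurable _
    | inr j => exact ((hW.measurable _).const_mul _).add ((hWhat.measurable _).const_mul _)
  have := Measure.isProbabilityMeasure_map (μ := P) hZ.aemeasurable
  have key := abs_cov_le_of_charFun a N hN hr hθ (P.map Z) (fun t => ?_) f g
  · have hm : ∀ φ : EuclideanSpace ℝ (J ⊕ J) → ℝ, Continuous φ →
        ∫ z, φ z ∂(P.map Z) = ∫ ω, φ (Z ω) ∂P := fun φ hφ =>
      integral_map hZ.aemeasurable hφ.aestronglyMeasurable
    have hfc : Continuous fun z : EuclideanSpace ℝ (J ⊕ J) => f (fun j => z (Sum.inl j)) :=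
      f.continuous.comp (by fun_prop)
    have hgc : Continuous fun z : EuclideanSpace ℝ (J ⊕ J) => g (fun j => z (Sum.inr j)) :=
      g.continuous.comp (by fun_prop)
    have hr0 : 0 ≤ r := hr.symm.nonneg
    rw [hm _ hfc, hm _ hgc,
      hm (fun z => f (fun j => z (Sum.inl j)) * g (fun j => z (Sum.inr j))) (hfc.mul hgc),
      hm (fun z => f (fun j => z (Sum.inl j)) ^ 2) (hfc.pow 2),
      hm (fun z => g (fun j => z (Sum.inr j)) ^ 2) (hgc.pow 2),
      hm _ (hfc.abs.rpow_const fun _ => Or.inr hr0),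
      hm _ (hgc.abs.rpow_const fun _ => Or.inr hr0)] at key
    subst hF hG
    exact key
  · have e := charFun_correlated_isonormal hW hWhat hind hθI h (fun j => t (Sum.inl j))
      (fun j => t (Sum.inr j))
    have hmeas : Measurable fun ω => ∑ j, t (Sum.inl j) * W (h j) ω +
        ∑ j, t (Sum.inr j) * (θ * W (h j) ω + √(1 - θ ^ 2) * What (h j) ω) :=
      (hW.measurable_sum h _).add (Finset.measurable_sum _ fun j _ =>
        (((hW.measurable _).const_mul _).add ((hWhat.measurable _).const_mul _)).const_mul _)
    have e' : charFun (P.map Z) t = charFun (P.map fun ω => ∑ j, t (Sum.inl j) * W (h j) ω +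
        ∑ j, t (Sum.inr j) * (θ * W (h j) ω + √(1 - θ ^ 2) * What (h j) ω)) 1 := by
      rw [charFun_apply, charFun_apply, integral_map hZ.aemeasurable
        (by fun_prop), integral_map hmeas.aemeasurable (by fun_prop)]
      congr 1
      ext ω
      congr 3
      simp only [PiLp.inner_apply, Fintype.sum_sum_type, Z, Sum.elim_inl, Sum.elim_inr,
        RCLike.inner_apply, conj_trivial, one_mul]
    -- It remains to match, coordinate by coordinate, `(A + θB)² + (1 - θ²)B² = A² + B² + 2θAB`.
    rw [e', e, ha, ha]
    congr 4
    rw [Finset.mul_sum, ← Finset.sum_add_distrib]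
    refine Finset.sum_congr rfl fun l _ => ?_
    have : ∑ j, (t (Sum.inl j) + θ * t (Sum.inr j)) * a j l =
        (∑ j, t (Sum.inl j) * a j l) + θ * ∑ j, t (Sum.inr j) * a j l := by
      rw [Finset.mul_sum, ← Finset.sum_add_distrib]
      exact Finset.sum_congr rfl fun _ _ => by ring
    rw [this]
    ring

end Isonormal

/-! ### Density of cylinder functions and passage to the limit -/

lemma MeasureTheory.MemLp.toReal_eLpNorm_ofReal {α : Type*} [MeasurableSpace α] {μ : Measure α}
    {f : α → ℝ} {p : ℝ} (hp : 0 < p) (hf : MemLp f (ENNReal.ofReal p) μ) :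
    (eLpNorm f (ENNReal.ofReal p) μ).toReal = (∫ x, |f x| ^ p ∂μ) ^ (1 / p) := by
  rw [hf.eLpNorm_eq_integral_rpow_norm (by simpa using hp) ENNReal.ofReal_ne_top,
    ENNReal.toReal_ofReal hp.le, ENNReal.toReal_ofReal (by positivity), one_div]
  rfl

lemma abs_integral_mul_le_eLpNorm {α : Type*} [MeasurableSpace α] {μ : Measure α}
    {f g : α → ℝ} {p q : ℝ} (hpq : p.HolderConjugate q) (hf : MemLp f (ENNReal.ofReal p) μ)
    (hg : MemLp g (ENNReal.ofReal q) μ) :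
    |∫ x, f x * g x ∂μ| ≤ (eLpNorm f (ENNReal.ofReal p) μ).toReal *
      (eLpNorm g (ENNReal.ofReal q) μ).toReal := by
  rw [hf.toReal_eLpNorm_ofReal hpq.pos, hg.toReal_eLpNorm_ofReal hpq.symm.pos]
  refine (abs_integral_le_integral_abs).trans ?_
  simp only [abs_mul]
  exact integral_mul_norm_le_Lp_mul_Lq hpq hf hg

lemma MeasureTheory.MemLp.integrable_mul_of_conj {α : Type*} [MeasurableSpace α] {μ : Measure α}
    {f g : α → ℝ} {p q : ℝ} (hpq : p.HolderConjugate q) (hf : MemLp f (ENNReal.ofReal p) μ)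
    (hg : MemLp g (ENNReal.ofReal q) μ) : Integrable (fun x => f x * g x) μ := by
  have := hpq.ennrealOfReal
  exact hf.integrable_mul hg

lemma tendsto_eLpNorm_toReal {α : Type*} [MeasurableSpace α] {μ : Measure α} {p : ENNReal}
    (hp : 1 ≤ p) {f : α → ℝ} {u : ℕ → α → ℝ} (hf : MemLp f p μ) (hu : ∀ n, MemLp (u n) p μ)
    (h : Tendsto (fun n => (eLpNorm (u n - f) p μ).toReal) atTop (𝓝 0)) :
    Tendsto (fun n => (eLpNorm (u n) p μ).toReal) atTop (𝓝 (eLpNorm f p μ).toReal) := by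
  rw [tendsto_iff_norm_sub_tendsto_zero]
  refine squeeze_zero (fun _ => norm_nonneg _) (fun n => ?_) h
  have tri : ∀ a b : α → ℝ, MemLp a p μ → MemLp b p μ →
      (eLpNorm a p μ).toReal ≤ (eLpNorm (a - b) p μ).toReal + (eLpNorm b p μ).toReal := by
    intro a b ha hb
    rw [← ENNReal.toReal_add (ha.sub hb).eLpNorm_ne_top hb.eLpNorm_ne_top]
    refine ENNReal.toReal_mono
      (ENNReal.add_ne_top.2 ⟨(ha.sub hb).eLpNorm_ne_top, hb.eLpNorm_ne_top⟩) ?_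
    simpa using eLpNorm_add_le (ha.sub hb).aestronglyMeasurable hb.aestronglyMeasurable hp
  have h₁ := tri _ _ (hu n) hf
  have h₂ := tri _ _ hf (hu n)
  rw [eLpNorm_sub_comm] at h₂
  rw [Real.norm_eq_abs, abs_le]
  constructor <;> linarith

/-- Split `uw - fg = (u - f)w + f(w - g)` and apply Hölder; the norms of `w n` converge. -/
lemma tendsto_integral_mul {α : Type*} [MeasurableSpace α] {μ : Measure α} {p q : ℝ}
    (hpq : p.HolderConjugate q) {f g : α → ℝ} {u w : ℕ → α → ℝ}
    (hf : MemLp f (ENNReal.ofReal p) μ) (hg : MemLp g (ENNReal.ofReal q) μ)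
    (hu : ∀ n, MemLp (u n) (ENNReal.ofReal p) μ) (hw : ∀ n, MemLp (w n) (ENNReal.ofReal q) μ)
    (hfu : Tendsto (fun n => (eLpNorm (u n - f) (ENNReal.ofReal p) μ).toReal) atTop (𝓝 0))
    (hgw : Tendsto (fun n => (eLpNorm (w n - g) (ENNReal.ofReal q) μ).toReal) atTop (𝓝 0)) :
    Tendsto (fun n => ∫ x, u n x * w n x ∂μ) atTop (𝓝 (∫ x, f x * g x ∂μ)) := by
  rw [tendsto_iff_norm_sub_tendsto_zero]
  have hq1 : 1 ≤ ENNReal.ofReal q := by simpa using hpq.symm.lt.le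
  have hlim := (hfu.mul (tendsto_eLpNorm_toReal hq1 hg hw hgw)).add
    (hgw.const_mul (eLpNorm f (ENNReal.ofReal p) μ).toReal)
  rw [zero_mul, mul_zero, add_zero] at hlim
  refine squeeze_zero (fun _ => norm_nonneg _) (fun n => ?_) hlim
  have e : ∫ x, u n x * w n x ∂μ - ∫ x, f x * g x ∂μ =
      ∫ x, (u n - f) x * w n x ∂μ + ∫ x, f x * (w n - g) x ∂μ := by
    rw [← integral_sub ((hu n).integrable_mul_of_conj hpq (hw n)) (hf.integrable_mul_of_conj hpq hg),
      ← integral_add (((hu n).sub hf).integrable_mul_of_conj hpq (hw n))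
        (hf.integrable_mul_of_conj hpq ((hw n).sub hg))]
    congr 1
    ext x
    simp only [Pi.sub_apply]
    ring
  rw [e]
  exact (norm_add_le _ _).trans (add_le_add
    (abs_integral_mul_le_eLpNorm hpq ((hu n).sub hf) (hw n))
    (abs_integral_mul_le_eLpNorm hpq hf ((hw n).sub hg)))

/-- `f` is a bounded continuous function of finitely many coordinates. -/
def IsBoundedCylinder {T : Type*} (f : (T → ℝ) → ℝ) : Prop :=
  ∃ (I : Finset T) (φ : BoundedContinuousFunction (I → ℝ) ℝ), f = fun x => φ (I.restrict x)

section Cylinder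

variable {T : Type*}

lemma IsBoundedCylinder.exists_of_subset {I J : Finset T} (h : I ⊆ J)
    (φ : BoundedContinuousFunction (I → ℝ) ℝ) :
    ∃ ψ : BoundedContinuousFunction (J → ℝ) ℝ, ∀ x : T → ℝ,
      φ (I.restrict x) = ψ (J.restrict x) :=
  ⟨φ.compContinuous ⟨Finset.restrict₂ (π := fun _ => ℝ) h,
    continuous_pi fun _ => continuous_apply _⟩, fun _ => rfl⟩

lemma IsBoundedCylinder.exists_common {f g : (T → ℝ) → ℝ} (hf : IsBoundedCylinder f)
    (hg : IsBoundedCylinder g) : ∃ (I : Finset T) (φ ψ : BoundedContinuousFunction (I → ℝ) ℝ),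
      f = (fun x => φ (I.restrict x)) ∧ g = fun x => ψ (I.restrict x) := by
  classical
  obtain ⟨I, φ, rfl⟩ := hf
  obtain ⟨J, ψ, rfl⟩ := hg
  obtain ⟨φ', h₁⟩ := exists_of_subset (Finset.subset_union_left (s₁ := I) (s₂ := J)) φ
  obtain ⟨ψ', h₂⟩ := exists_of_subset (Finset.subset_union_right (s₁ := I) (s₂ := J)) ψ
  exact ⟨I ∪ J, φ', ψ', funext h₁, funext h₂⟩

lemma IsBoundedCylinder.add {f g : (T → ℝ) → ℝ} (hf : IsBoundedCylinder f)
    (hg : IsBoundedCylinder g) : IsBoundedCylinder (f + g) := by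
  obtain ⟨I, φ, ψ, rfl, rfl⟩ := hf.exists_common hg
  exact ⟨I, φ + ψ, rfl⟩

lemma IsBoundedCylinder.measurable {f : (T → ℝ) → ℝ} (hf : IsBoundedCylinder f) :
    Measurable f := by
  obtain ⟨I, φ, rfl⟩ := hf
  exact φ.continuous.measurable.comp (Finset.measurable_restrict I)

lemma IsBoundedCylinder.memLp {f : (T → ℝ) → ℝ} (hf : IsBoundedCylinder f)
    (μ : Measure (T → ℝ)) [IsFiniteMeasure μ] (p : ENNReal) : MemLp f p μ := by
  have hm := hf.measurable
  obtain ⟨I, φ, rfl⟩ := hf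
  exact MemLp.of_bound hm.aestronglyMeasurable ‖φ‖ (ae_of_all _ fun x => φ.norm_coe_le_norm _)

open scoped symmDiff in
/-- Bounded continuous cylinder functions are dense in `Lᵖ`. -/
lemma exists_isBoundedCylinder_eLpNorm_sub_le (μ : Measure (T → ℝ)) [IsProbabilityMeasure μ]
    {p : ENNReal} (hp1 : 1 ≤ p) (hp : p ≠ ⊤) {f : (T → ℝ) → ℝ} (hf : MemLp f p μ)
    {ε : ENNReal} (hε : ε ≠ 0) :
    ∃ g, eLpNorm (f - g) p μ ≤ ε ∧ IsBoundedCylinder g := by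
  refine hf.induction_dense hp IsBoundedCylinder (fun c s hs _ ε hε => ?_)
    (fun _ _ => IsBoundedCylinder.add) (fun g hg => hg.measurable.aestronglyMeasurable) hε
  have hε2 : ε / 2 ≠ 0 := (ENNReal.half_pos hε).ne'
  obtain ⟨η, hη, hη'⟩ := exists_eLpNorm_indicator_le (μ := μ) hp c hε2
  -- Measurable cylinders form a ring generating the product σ-algebra, so `s` is close in measure
  -- to a cylinder. The indicator of its base is then smoothed under the finite-dimensional
  -- marginal.
  obtain ⟨t, ht, hts⟩ := exists_measure_symmDiff_lt_of_generateFrom_isSetRing (μ := μ)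
    (isSetRing_measurableCylinders (α := fun _ : T => ℝ))
    ⟨{Set.univ}, Set.countable_singleton _, by
      simpa using univ_mem_measurableCylinders (fun _ : T => ℝ), by simp⟩
    generateFrom_measurableCylinders.symm hs (ε := η) (by exact_mod_cast hη)
  obtain ⟨I, S, hS, rfl⟩ := (mem_measurableCylinders t).1 ht
  have := Measure.isProbabilityMeasure_map (μ := μ)
    (Finset.measurable_restrict (X := fun _ : T => ℝ) I).aemeasurable
  obtain ⟨φ, hφ, -⟩ := (memLp_indicator_const (μ := μ.map (I.restrict (π := fun _ => ℝ))) p hS c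
    (Or.inr (measure_ne_top _ _))).exists_boundedContinuous_eLpNorm_sub_le hp hε2
  refine ⟨fun x => φ (I.restrict x), ?_, I, φ, rfl⟩
  have hmS : MeasurableSet (cylinder (α := fun _ : T => ℝ) I S) := hS.cylinder I
  have hcyl : (cylinder (α := fun _ : T => ℝ) I S).indicator (fun _ => c) =
      S.indicator (fun _ => c) ∘ I.restrict (π := fun _ => ℝ) := by
    ext x; rfl
  have h₁ : eLpNorm ((fun x : T → ℝ => φ (I.restrict x)) -
      (cylinder (α := fun _ : T => ℝ) I S).indicator fun _ => c) p μ ≤ ε / 2 := by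
    rw [eLpNorm_sub_comm, hcyl]
    rw [eLpNorm_map_measure ((((measurable_const.indicator hS).sub
      φ.continuous.measurable)).aestronglyMeasurable)
      (Finset.measurable_restrict (X := fun _ : T => ℝ) I).aemeasurable] at hφ
    exact hφ
  have h₂ : eLpNorm ((cylinder (α := fun _ : T => ℝ) I S).indicator (fun _ => c) -
      s.indicator fun _ => c) p μ ≤ ε / 2 := by
    refine (eLpNorm_mono fun x => ?_).trans (hη' _ hts.le)
    by_cases h₁ : x ∈ cylinder (α := fun _ : T => ℝ) I S <;> by_cases h₂ : x ∈ s <;>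
      simp [Set.indicator, Set.mem_symmDiff, h₁, h₂, -mem_cylinder]
  have hm₁ : Measurable fun x : T → ℝ => φ (I.restrict x) :=
    IsBoundedCylinder.measurable ⟨I, φ, rfl⟩
  have hadd := eLpNorm_add_le (μ := μ)
    (hm₁.sub (measurable_const.indicator (f := fun _ => c) hmS)).aestronglyMeasurable
    ((measurable_const.indicator (f := fun _ => c) hmS).sub
      (measurable_const.indicator (f := fun _ => c) hs)).aestronglyMeasurable hp1
  have hsum : (fun x : T → ℝ => φ (I.restrict x)) - s.indicator (fun _ => c) =
      ((fun x : T → ℝ => φ (I.restrict x)) -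
        (cylinder (α := fun _ : T => ℝ) I S).indicator fun _ => c) +
      ((cylinder (α := fun _ : T => ℝ) I S).indicator (fun _ => c) - s.indicator fun _ => c) := by
    abel
  rw [hsum]
  exact hadd.trans ((add_le_add h₁ h₂).trans (ENNReal.add_halves ε).le)

lemma exists_isBoundedCylinder_tendsto (μ : Measure (T → ℝ)) [IsProbabilityMeasure μ]
    {p : ENNReal} (hp1 : 1 ≤ p) (hp : p ≠ ⊤) {f : (T → ℝ) → ℝ} (hf : MemLp f p μ) :
    ∃ u : ℕ → (T → ℝ) → ℝ, (∀ n, IsBoundedCylinder (u n)) ∧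
      Tendsto (fun n => (eLpNorm (u n - f) p μ).toReal) atTop (𝓝 0) := by
  choose u hu hc using fun n : ℕ => exists_isBoundedCylinder_eLpNorm_sub_le μ hp1 hp hf
    (ε := ENNReal.ofReal (1 / (n + 1))) (by simp; positivity)
  refine ⟨u, hc, squeeze_zero (fun _ => ENNReal.toReal_nonneg) (fun n => ?_)
    tendsto_one_div_add_atTop_nhds_zero_nat⟩
  rw [eLpNorm_sub_comm]
  exact ENNReal.toReal_le_of_le_ofReal (by positivity) (hu n)

/-- A covariance estimate for two random functions with the same law extends from bounded
continuous cylinder functions to `Lᵖ × L^q`. -/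
theorem abs_cov_le_of_forall_isBoundedCylinder {Ω : Type*} [MeasurableSpace Ω] {P : Measure Ω}
    [IsProbabilityMeasure P] {U V : Ω → T → ℝ} (hU : Measurable U) (hV : Measurable V)
    {p q K : ℝ} (hpq : p.HolderConjugate q)
    (hK : ∀ f g : (T → ℝ) → ℝ, IsBoundedCylinder f → IsBoundedCylinder g →
      |∫ ω, f (U ω) * g (V ω) ∂P - (∫ ω, f (U ω) ∂P) * ∫ ω, g (V ω) ∂P| ≤
        K * ((eLpNorm (fun ω => f (U ω)) (ENNReal.ofReal p) P).toReal *
          (eLpNorm (fun ω => g (V ω)) (ENNReal.ofReal q) P).toReal))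
    {f g : (T → ℝ) → ℝ} (hfm : Measurable f) (hgm : Measurable g)
    (hf : MemLp (fun ω => f (U ω)) (ENNReal.ofReal p) P)
    (hg : MemLp (fun ω => g (V ω)) (ENNReal.ofReal q) P) :
    |∫ ω, f (U ω) * g (V ω) ∂P - (∫ ω, f (U ω) ∂P) * ∫ ω, g (V ω) ∂P| ≤
        K * ((eLpNorm (fun ω => f (U ω)) (ENNReal.ofReal p) P).toReal *
          (eLpNorm (fun ω => g (V ω)) (ENNReal.ofReal q) P).toReal) := by
  have hp1 : 1 ≤ ENNReal.ofReal p := by simpa using hpq.lt.le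
  have hq1 : 1 ≤ ENNReal.ofReal q := by simpa using hpq.symm.lt.le
  have approx : ∀ {s : ENNReal} {X : Ω → T → ℝ} {h : (T → ℝ) → ℝ}, 1 ≤ s → s ≠ ⊤ →
      Measurable X → Measurable h → MemLp (fun ω => h (X ω)) s P →
      ∃ u : ℕ → (T → ℝ) → ℝ, (∀ n, IsBoundedCylinder (u n)) ∧
        (∀ n, MemLp (fun ω => u n (X ω)) s P) ∧
        Tendsto (fun n => (eLpNorm ((fun ω => u n (X ω)) - fun ω => h (X ω)) s P).toReal)
          atTop (𝓝 0) := by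
    intro s X h hs1 hs hX hh hL
    have := Measure.isProbabilityMeasure_map (μ := P) hX.aemeasurable
    obtain ⟨u, hu, hlim⟩ := exists_isBoundedCylinder_tendsto (P.map X) hs1 hs
      ((memLp_map_measure_iff hh.aestronglyMeasurable hX.aemeasurable).2 hL)
    refine ⟨u, hu, fun n => (memLp_map_measure_iff (hu n).measurable.aestronglyMeasurable
      hX.aemeasurable).1 ((hu n).memLp (P.map X) s), ?_⟩
    simp only [eLpNorm_map_measure ((hu _).measurable.sub hh).aestronglyMeasurable
      hX.aemeasurable] at hlim
    exact hlim
  obtain ⟨u, huc, huL, hul⟩ := approx hp1 ENNReal.ofReal_ne_top hU hfm hf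
  obtain ⟨w, hwc, hwL, hwl⟩ := approx hq1 ENNReal.ofReal_ne_top hV hgm hg
  have one_mem : ∀ s : ENNReal, MemLp (fun _ : Ω => (1 : ℝ)) s P := fun s => memLp_const 1
  have t₁ := tendsto_integral_mul hpq hf hg huL hwL hul hwl
  -- Pairing with the constant `1` gives convergence of the means.
  have t₂ := tendsto_integral_mul hpq hf (one_mem _) huL (fun _ => one_mem _) hul (by simp)
  have t₃ := tendsto_integral_mul hpq (one_mem _) hg (fun _ => one_mem _) hwL (by simp) hwl
  simp only [mul_one, one_mul] at t₂ t₃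
  exact le_of_tendsto_of_tendsto (t₁.sub (t₂.mul t₃)).abs
    (((tendsto_eLpNorm_toReal hp1 hf huL hul).mul
      (tendsto_eLpNorm_toReal hq1 hg hwL hwl)).const_mul K)
    (Eventually.of_forall fun n => hK _ _ (huc n) (hwc n))

end Cylinder

/-! ### The covariance inequality -/

lemma rpow_integral_le_eLpNorm {Ω : Type*} [MeasurableSpace Ω] {P : Measure Ω}
    [IsProbabilityMeasure P] {f : Ω → ℝ} {s p : ℝ} (hs : 0 < s) (hsp : s ≤ p)
    (hf : MemLp f (ENNReal.ofReal p) P) :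
    (∫ ω, |f ω| ^ s ∂P) ^ (1 / s) ≤ (eLpNorm f (ENNReal.ofReal p) P).toReal := by
  have hle := ENNReal.ofReal_le_ofReal hsp
  rw [← (hf.mono_exponent hle).toReal_eLpNorm_ofReal hs]
  exact ENNReal.toReal_mono hf.eLpNorm_ne_top
    (eLpNorm_le_eLpNorm_of_exponent_le hle hf.aestronglyMeasurable)

lemma sqrt_integral_sq_le_eLpNorm {Ω : Type*} [MeasurableSpace Ω] {P : Measure Ω}
    [IsProbabilityMeasure P] {f : Ω → ℝ} {p : ℝ} (hp : 2 ≤ p)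
    (hf : MemLp f (ENNReal.ofReal p) P) :
    √(∫ ω, f ω ^ 2 ∂P) ≤ (eLpNorm f (ENNReal.ofReal p) P).toReal := by
  have := rpow_integral_le_eLpNorm two_pos hp hf
  simpa only [Real.rpow_two, sq_abs, ← Real.sqrt_eq_rpow] using this

/-- The covariance inequality for small correlations. -/
theorem abs_cov_isonormal_le {H : Type u} [NormedAddCommGroup H] [InnerProductSpace ℝ H]
    {Ω : Type v} [MeasurableSpace Ω] {P : Measure Ω} [IsProbabilityMeasure P]
    {W What : H → Ω → ℝ} (hW : IsIsonormalProcess W P) (hWhat : IsIsonormalProcess What P)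
    (hind : IndepFun (fun ω h => W h ω) (fun ω h => What h ω) P) {p q : ℝ}
    (hpq : p.HolderConjugate q) {N : ℕ} (hN : 0 < N) (hpN : p ≤ 2 * N) (hqN : q ≤ 2 * N)
    {θ : ℝ} (hθ : |θ| ≤ 1 / (2 * N)) {f g : (H → ℝ) → ℝ} (hfm : Measurable f)
    (hgm : Measurable g) (hf : MemLp (fun ω => f fun h => W h ω) (ENNReal.ofReal p) P)
    (hg : MemLp (fun ω => g fun h => θ * W h ω + √(1 - θ ^ 2) * What h ω)
      (ENNReal.ofReal q) P) :
    |∫ ω, f (fun h => W h ω) * g (fun h => θ * W h ω + √(1 - θ ^ 2) * What h ω) ∂P -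
        (∫ ω, f (fun h => W h ω) ∂P) *
          ∫ ω, g (fun h => θ * W h ω + √(1 - θ ^ 2) * What h ω) ∂P| ≤
      2 * N * |θ| * ((eLpNorm (fun ω => f fun h => W h ω) (ENNReal.ofReal p) P).toReal *
        (eLpNorm (fun ω => g fun h => θ * W h ω + √(1 - θ ^ 2) * What h ω)
          (ENNReal.ofReal q) P).toReal) := by
  have hN' : (1 : ℝ) ≤ N := by exact_mod_cast hN
  have hU : Measurable fun ω h => W h ω := measurable_pi_lambda _ hW.measurable
  have hV : Measurable fun ω h => θ * W h ω + √(1 - θ ^ 2) * What h ω :=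
    measurable_pi_lambda _ fun h =>
      ((hW.measurable h).const_mul _).add ((hWhat.measurable h).const_mul _)
  refine abs_cov_le_of_forall_isBoundedCylinder hU hV hpq (fun f g hf hg => ?_) hfm hgm hf hg
  have hbdd : ∀ {X : Ω → H → ℝ} {f : (H → ℝ) → ℝ} (s : ENNReal), Measurable X →
      IsBoundedCylinder f → MemLp (fun ω => f (X ω)) s P := by
    intro X f s hX hf
    have := Measure.isProbabilityMeasure_map (μ := P) hX.aemeasurable
    exact (memLp_map_measure_iff hf.measurable.aestronglyMeasurable hX.aemeasurable).1
      (hf.memLp _ s)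
  have hF := hbdd (ENNReal.ofReal p) hU hf
  have hG := hbdd (ENNReal.ofReal q) hV hg
  obtain ⟨I, φ, ψ, hφ, hψ⟩ := hf.exists_common hg
  have hr : (2 * N : ℝ).HolderConjugate (Real.conjExponent (2 * N)) :=
    Real.HolderConjugate.conjExponent (by linarith)
  set r := Real.conjExponent (2 * N) with hrdef
  have hr0 : 0 < r := hr.symm.pos
  -- Conjugation reverses order, so the upper bounds on `p` and `q` give `r ≤ q` and `r ≤ p`.
  have conj_le : ∀ {a b : ℝ}, a.HolderConjugate b → a ≤ 2 * N → r ≤ b := by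
    intro a b hab ha
    have h₁ := hab.inv_add_inv_eq_one
    have h₂ := hr.inv_add_inv_eq_one
    have h₃ := inv_anti₀ hab.pos ha
    exact (inv_le_inv₀ hab.symm.pos hr0).1 (by linarith)
  obtain ⟨b₁, b₂⟩ := abs_cov_le_of_boundedContinuous hW hWhat hind N hN hr hθ
    (fun j : I => (j : H)) φ ψ (F := fun ω => f fun h => W h ω)
    (G := fun ω => g fun h => θ * W h ω + √(1 - θ ^ 2) * What h ω)
    (by rw [hφ]; rfl) (by rw [hψ]; rfl)
  -- The exponent that is at least `2` dominates the `L²` norm; this decides which of the two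
  -- estimates is used.
  rcases le_total 2 p with h2 | h2
  · refine b₁.trans ?_
    gcongr
    · exact sqrt_integral_sq_le_eLpNorm h2 hF
    · exact rpow_integral_le_eLpNorm hr0 (conj_le hpq hpN) hG
  · have hq2 : 2 ≤ q := by
      have h₁ := hpq.inv_add_inv_eq_one
      have h₂ := inv_anti₀ hpq.pos h2
      have h₃ : q⁻¹ ≤ 2⁻¹ := by linarith
      exact (inv_le_inv₀ hpq.symm.pos two_pos).1 h₃
    refine b₂.trans ?_
    rw [mul_comm (√_)]
    gcongr
    · exact rpow_integral_le_eLpNorm hr0 (conj_le hpq.symm hqN) hF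
    · exact sqrt_integral_sq_le_eLpNorm hq2 hG

theorem proposition2p5 (p q : ℝ) (hp : 1 < p) (hpq : 1 / p + 1 / q = 1) :
    ∃ C : ℝ, ∀ (H : Type u) [NormedAddCommGroup H] [InnerProductSpace ℝ H] [CompleteSpace H]
      [TopologicalSpace.SeparableSpace H]
      (Ω : Type v) [MeasurableSpace Ω] (P : Measure Ω) [IsProbabilityMeasure P]
      (W What : H → Ω → ℝ),
      IsIsonormalProcess W P → IsIsonormalProcess What P →
      IndepFun (fun ω h => W h ω) (fun ω h => What h ω) P →
      ∀ F₁ F₂ : (H → ℝ) → ℝ, Measurable F₁ → Measurable F₂ →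
        MemLp (fun ω => F₁ (fun h => W h ω)) (ENNReal.ofReal p) P →
        MemLp (fun ω => F₂ (fun h => W h ω)) (ENNReal.ofReal q) P →
        ∫ ω, F₁ (fun h => W h ω) ∂P = 0 →
        ∫ ω, F₂ (fun h => W h ω) ∂P = 0 →
        ∀ θ ∈ Set.Icc (-1 : ℝ) 1,
          Integrable (fun ω => F₁ (fun h => W h ω) *
            F₂ (fun h => θ * W h ω + √(1 - θ ^ 2) * What h ω)) P ∧
          |∫ ω, F₁ (fun h => W h ω) *
            F₂ (fun h => θ * W h ω + √(1 - θ ^ 2) * What h ω) ∂P|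
            ≤ C * |θ| * (eLpNorm (fun ω => F₁ (fun h => W h ω)) (ENNReal.ofReal p) P).toReal
              * (eLpNorm (fun ω => F₂ (fun h => W h ω)) (ENNReal.ofReal q) P).toReal := by
  have hp0 : 0 < p := by linarith
  have hpq' : p.HolderConjugate q := Real.holderConjugate_iff.2 ⟨hp, by simpa using hpq⟩
  obtain ⟨N, hN⟩ := exists_nat_ge (max p q)
  have hpN : p ≤ N := (le_max_left _ _).trans hN
  have hqN : q ≤ N := (le_max_right _ _).trans hN
  have hN0 : (0 : ℝ) < N := hp0.trans_le hpN
  refine ⟨2 * N, ?_⟩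
  intro H _ _ _ _ Ω _ P _ W What hW hWhat hind F₁ F₂ hF₁ hF₂ hL₁ hL₂ hm₁ hm₂ θ hθ
  have hU : Measurable fun ω h => W h ω := measurable_pi_lambda _ hW.measurable
  have hV : Measurable fun ω h => θ * W h ω + √(1 - θ ^ 2) * What h ω :=
    measurable_pi_lambda _ fun h =>
      ((hW.measurable h).const_mul _).add ((hWhat.measurable h).const_mul _)
  have hlaw : IdentDistrib (fun ω h => W h ω)
      (fun ω h => θ * W h ω + √(1 - θ ^ 2) * What h ω) P P :=
    ⟨hU.aemeasurable, hV.aemeasurable, map_correlated_isonormal hW hWhat hind hθ⟩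
  have hlaw₂ := hlaw.comp hF₂
  have hL₂' : MemLp (fun ω => F₂ fun h => θ * W h ω + √(1 - θ ^ 2) * What h ω)
      (ENNReal.ofReal q) P := hlaw₂.memLp_iff.1 hL₂
  have hm₂' : ∫ ω, F₂ (fun h => θ * W h ω + √(1 - θ ^ 2) * What h ω) ∂P = 0 :=
    hlaw₂.integral_eq.symm.trans hm₂
  have hnorm : eLpNorm (fun ω => F₂ fun h => W h ω) (ENNReal.ofReal q) P =
      eLpNorm (fun ω => F₂ fun h => θ * W h ω + √(1 - θ ^ 2) * What h ω) (ENNReal.ofReal q) P :=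
    hlaw₂.eLpNorm_eq _
  refine ⟨hL₁.integrable_mul_of_conj hpq' hL₂', ?_⟩
  rw [hnorm, mul_assoc]
  rcases le_total |θ| (1 / (2 * N)) with h | h
  · have := abs_cov_isonormal_le hW hWhat hind hpq' (by exact_mod_cast hN0) (by linarith)
      (by linarith) h hF₁ hF₂ hL₁ hL₂'
    rwa [hm₁, zero_mul, sub_zero] at this
  -- Here `2N|θ| ≥ 1`, so Hölder alone is enough.
  · refine (abs_integral_mul_le_eLpNorm hpq' hL₁ hL₂').trans
      (le_mul_of_one_le_left (by positivity) ?_)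
    rw [div_le_iff₀ (by positivity)] at h
    linarith
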